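/- An ordered graph is a finite simple graph together with a linear order on its vertices. For ordered graphs $H$ and $G$, we say that $G$ is $H$-free if there is no strictly order-preserving map $f\colon V(H)\to V(G)$ such that, for all $a,b\in V(H)$, $f(a)f(b)\in E(G)$ if and only if $ab\in E(H)$. For a fixed integer $k\ge 0$, an instance of List $k$-Coloring is a pair $(G,L)$ of a graph $G$ and a function $L$ that assigns to every vertex of $G$ a list $L(v)\subseteq\{1,\dots,k\}$; the question is whether $G$ has a proper coloring $c$ with $c(v)\in L(v)$ for every vertex $v$. **Theorem 3.1.** Let $H$ be a fixed ordered graph with exactly one edge, and let $k$ be fixed. Then List $k$-Coloring is solvable in polynomial time on $H$-free ordered graphs. That is, there are an algorithm and a polynomial $T$, depending only on $H$ and $k$, such that for every instance $(G,L)$ of List $k$-Coloring in which $G$ is an $H$-free ordered graph, the algorithm decides $(G,L)$ correctly in at most $T(N)$ steps, where $N$ is the length of the binary encoding of $(G,L)$ (the number of vertices in unary, the adjacency matrix with the vertices in their order, and the lists as 0/1 vectors). The algorithm is a program for a random access machine with assignment, addition, truncated subtraction, indirect load and store, and tests for zero, each counted as one step. -/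

import Mathlib

/-! ### Random access machines with uniform cost -/

namespace RAM

/-- A machine state: registers (addressed directly by a program) and a random access memory
(addressed through the contents of registers). -/
@[ext]
structure State where
  reg : ℕ → ℕ
  mem : ℕ → ℕ

/-- Elementary instructions. There is no multiplication and there are no other instructions that
create long numbers quickly: `t` steps lengthen the binary representation of the largest number by
at most `t` bits plus a constant that depends on the program. Hence uniform cost is polynomially
equivalent to the time of Turing machines. -/
inductive Instr where
  /-- `r := c` -/
  | const (r c : ℕ)
  /-- `r := a` -/
  | copy (r a : ℕ)
  /-- `r := a + b` -/
  | add (r a b : ℕ)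
  /-- `r := max (a - b) 0` -/
  | sub (r a b : ℕ)
  /-- `r := mem[a]` -/
  | load (r a : ℕ)
  /-- `mem[a] := r` -/
  | store (a r : ℕ)

/-- The effect of one elementary instruction. -/
def Instr.apply : Instr → State → State
  | const r c, s => { s with reg := Function.update s.reg r c }
  | copy r a, s => { s with reg := Function.update s.reg r (s.reg a) }
  | add r a b, s => { s with reg := Function.update s.reg r (s.reg a + s.reg b) }
  | sub r a b, s => { s with reg := Function.update s.reg r (s.reg a - s.reg b) }
  | load r a, s => { s with reg := Function.update s.reg r (s.mem (s.reg a)) }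
  | store a r, s => { s with mem := Function.update s.mem (s.reg a) (s.reg r) }

/-- Programs: finite, and independent of the input. -/
inductive Prog where
  | instr (i : Instr)
  | seq (p q : Prog)
  /-- if register `r` is nonzero then `p` else `q` -/
  | branch (r : ℕ) (p q : Prog)
  /-- while register `r` is nonzero do `p` -/
  | loop (r : ℕ) (p : Prog)

/-- `Exec p s t s'`: the program `p`, started in state `s`, halts in state `s'` after exactly `t`
steps. Every elementary instruction and every test of a register counts as one step. -/
inductive Exec : Prog → State → ℕ → State → Prop where
  | instr (i : Instr) (s : State) : Exec (.instr i) s 1 (i.apply s)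
  | seq {p q : Prog} {s s' s'' : State} {t u : ℕ}
      (hp : Exec p s t s') (hq : Exec q s' u s'') : Exec (.seq p q) s (t + u) s''
  | branch_true {r : ℕ} {p q : Prog} {s s' : State} {t : ℕ}
      (hr : s.reg r ≠ 0) (hp : Exec p s t s') : Exec (.branch r p q) s (t + 1) s'
  | branch_false {r : ℕ} {p q : Prog} {s s' : State} {t : ℕ}
      (hr : s.reg r = 0) (hq : Exec q s t s') : Exec (.branch r p q) s (t + 1) s'
  | loop_false {r : ℕ} {p : Prog} {s : State}
      (hr : s.reg r = 0) : Exec (.loop r p) s 1 s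
  | loop_true {r : ℕ} {p : Prog} {s s' s'' : State} {t u : ℕ}
      (hr : s.reg r ≠ 0) (hp : Exec p s t s') (hl : Exec (.loop r p) s' u s'') :
      Exec (.loop r p) s (t + u + 1) s''

/-- Runs are unique: the machine is deterministic. -/
theorem Exec.unique {p : Prog} {s s₁ s₂ : State} {t₁ t₂ : ℕ}
    (h₁ : Exec p s t₁ s₁) (h₂ : Exec p s t₂ s₂) : t₁ = t₂ ∧ s₁ = s₂ := by
  induction h₁ generalizing t₂ s₂ with
  | instr i s => cases h₂; exact ⟨rfl, rfl⟩
  | seq _ _ ihp ihq =>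
    cases h₂ with
    | seq hp hq =>
      obtain ⟨rfl, rfl⟩ := ihp hp
      obtain ⟨rfl, rfl⟩ := ihq hq
      exact ⟨rfl, rfl⟩
  | branch_true hr _ ih =>
    cases h₂ with
    | branch_true _ hp => obtain ⟨rfl, rfl⟩ := ih hp; exact ⟨rfl, rfl⟩
    | branch_false hr' _ => exact absurd hr' hr
  | branch_false hr _ ih =>
    cases h₂ with
    | branch_true hr' _ => exact absurd hr hr'
    | branch_false _ hq => obtain ⟨rfl, rfl⟩ := ih hq; exact ⟨rfl, rfl⟩
  | loop_false hr =>
    cases h₂ with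
    | loop_false _ => exact ⟨rfl, rfl⟩
    | loop_true hr' _ _ => exact absurd hr hr'
  | loop_true hr _ _ ihp ihl =>
    cases h₂ with
    | loop_false hr' => exact absurd hr' hr
    | loop_true _ hp hl =>
      obtain ⟨rfl, rfl⟩ := ihp hp
      obtain ⟨rfl, rfl⟩ := ihl hl
      exact ⟨rfl, rfl⟩

/-- The initial state on a binary input word `w`: register `0` holds the length of `w`, the memory
cells `0, …, |w| - 1` hold the bits of `w`, and everything else is `0`. -/
def init (w : List Bool) : State where
  reg := fun r => if r = 0 then w.length else 0
  mem := fun i => if w.getD i false = true then 1 else 0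

/-- The decision problem with set of instances `I`, presented to the machine as binary words by
`enc`, and with yes-instances `Yes`, is solvable in polynomial time: one program halts on every
instance within a number of steps that is polynomial in the length of the encoding, with `1` in
register `0` on yes-instances and `0` in register `0` on no-instances. -/
def SolvableInPolyTime {I : Type} (enc : I → List Bool) (Yes : I → Prop) : Prop :=
  ∃ (p : Prog) (T : Polynomial ℕ), ∀ x : I, ∃ (t : ℕ) (s : State),
    Exec p (init (enc x)) t s ∧ t ≤ T.eval (enc x).length ∧
      (Yes x → s.reg 0 = 1) ∧ (¬ Yes x → s.reg 0 = 0)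

end RAM

/-! ### Ordered graphs and list colorings -/

/-- For ordered graphs (graphs on linearly ordered vertex sets), `G` is `H`-free: there is no
order-preserving injection of the vertices of `H` into those of `G` that preserves both
adjacency and non-adjacency. -/
def OrderedFree {V W : Type*} [LinearOrder V] [LinearOrder W]
    (H : SimpleGraph V) (G : SimpleGraph W) : Prop :=
  ¬ ∃ f : V ↪o W, ∀ a b : V, G.Adj (f a) (f b) ↔ H.Adj a b

/-- An instance of List `k`-Coloring on an ordered graph. The vertices are listed in
their linear order, i.e. they are `0 < 1 < … < n - 1`; the `k` colors are the elements of
`Fin k`, and every vertex has a list of colors. -/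
structure ListColInstance (k : ℕ) where
  n : ℕ
  G : SimpleGraph (Fin n)
  L : Fin n → Finset (Fin k)

namespace ListColInstance

variable {k : ℕ}

/-- There is a proper coloring in which every vertex receives a color from its list. -/
def IsYes (x : ListColInstance k) : Prop :=
  ∃ c : x.G.Coloring (Fin k), ∀ v, c v ∈ x.L v

open Classical in
/-- The encoding of an instance: the number `n` of vertices in unary, terminated by a `0`, the
`n × n` adjacency matrix row by row, and the `n × k` incidence matrix of the lists row by row. -/
noncomputable def encode (x : ListColInstance k) : List Bool :=
  List.replicate x.n true ++ [false] ++
    List.ofFn (fun i : Fin (x.n * x.n) => decide (x.G.Adj i.divNat i.modNat)) ++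
    List.ofFn (fun i : Fin (x.n * k) => decide (i.modNat ∈ x.L i.divNat))

end ListColInstance

/-! Let `H` have `m` vertices and one edge, and let `G` be `H`-free. To find a list coloring of `G`,
guess for each color the first `m` and the last `m` vertices of its color class; these guesses have
to be independent sets. Then color the vertices from left to right and, for each color, remember
only the `m` vertices that received it most recently, its window. When a vertex `v` gets color
`i`, require that it is adjacent to nothing in the window of `i` and to nothing in the guess for
`i`, and that it either belongs to this guess or lies between its two halves.

These local checks suffice (`Sweep.Cell.isYes`). Suppose that the ends of an edge `u v` have the
same color, with `v - u` as small as possible. As the check of `v` against the window did not see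
`u`, at least `m` vertices of this color lie between `u` and `v`. By minimality they are pairwise
nonadjacent and not adjacent to `u` or `v`. The guess supplies `m` vertices before `u` and `m`
after `v`, and none of them has a neighbor among the vertices of this color or in the guess. So all
isolated vertices of `H` find their places around the edge `u v`, wherever they are in the order,
and `G` contains `H` (`Sweep.not_orderedFree_of_conflict`).

A state, which consists of the guesses and the windows, is a tuple of at most `3 * m * k` vertices.
Hence there are polynomially many states, and a table that says from which states the last `t`
vertices can be colored is filled for `t = 0, 1, …`.

To run this on the random access machine, a small language is compiled to it, whose only loops are
`for x < N` with `N` the input length. Every program of this language runs in polynomial time, with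
a bound that is read off from its text (`RAM.Stmt.exec_compile`), so that only its correctness
remains to be proved (`Sweep.run_program_reg_ne_zero`). -/

/-! ### A language of bounded loops -/

namespace RAM

/-- The state `s` with `a` written into register `x`. -/
def State.set (s : State) (x a : ℕ) : State := { s with reg := Function.update s.reg x a }

@[simp] theorem State.set_mem (s : State) (x a : ℕ) : (s.set x a).mem = s.mem := rfl

@[simp] theorem State.set_reg_self (s : State) (x a : ℕ) : (s.set x a).reg x = a := by
  simp [State.set]

theorem State.set_reg_of_ne (s : State) {x r : ℕ} (a : ℕ) (h : r ≠ x) :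
    (s.set x a).reg r = s.reg r := by
  simp [State.set, h]

/-- Arithmetic expressions over registers and memory. -/
inductive Expr where
  | const (c : ℕ)
  | var (x : ℕ)
  | add (a b : Expr)
  | sub (a b : Expr)
  | mul (a b : Expr)
  | load (a : Expr)

namespace Expr

/-- The value of an expression. In a product the left factor is capped by the content of register
`0`, so that products take a number of steps that is bounded in terms of register `0`. -/
def eval (s : State) : Expr → ℕ
  | const c => c
  | var x => s.reg x
  | add a b => a.eval s + b.eval s
  | sub a b => a.eval s - b.eval s
  | mul a b => min (a.eval s) (s.reg 0) * b.eval s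
  | load a => s.mem (a.eval s)

/-- A strict upper bound for the registers that an expression reads. -/
def bound : Expr → ℕ
  | const _ => 1
  | var x => x + 1
  | add a b => max a.bound b.bound
  | sub a b => max a.bound b.bound
  | mul a b => max a.bound b.bound
  | load a => a.bound

theorem one_le_bound (e : Expr) : 1 ≤ e.bound := by
  induction e <;> simp_all [bound]

/-- A program that writes the value of the expression into register `d` and changes only registers
from `d` on. -/
def compile : Expr → ℕ → Prog
  | const c, d => .instr (.const d c)
  | var x, d => .instr (.copy d x)
  | add a b, d => .seq (a.compile d) (.seq (b.compile (d + 1)) (.instr (.add d d (d + 1))))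
  | sub a b, d => .seq (a.compile d) (.seq (b.compile (d + 1)) (.instr (.sub d d (d + 1))))
  | mul a b, d => .seq (a.compile d) (.seq (b.compile (d + 1))
      -- `x - (x - y) = min x y` caps the number of rounds of the loop.
      (.seq (.instr (.sub (d + 2) d 0)) (.seq (.instr (.sub d d (d + 2)))
      (.seq (.instr (.const (d + 2) 0)) (.seq (.instr (.const (d + 3) 1))
      (.seq (.loop d (.seq (.instr (.add (d + 2) (d + 2) (d + 1)))
        (.instr (.sub d d (d + 3))))) (.instr (.copy d (d + 2)))))))))
  | load a, d => .seq (a.compile d) (.instr (.load d d))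

open Polynomial in
/-- A bound for the number of steps of the compiled expression, in terms of register `0`. -/
noncomputable def time : Expr → Polynomial ℕ
  | const _ => 1
  | var _ => 1
  | add a b => a.time + b.time + 1
  | sub a b => a.time + b.time + 1
  | mul a b => a.time + b.time + 3 * X + 6
  | load a => a.time + 1

theorem eval_congr {s s' : State} (hm : s.mem = s'.mem) :
    ∀ e : Expr, (∀ r < e.bound, s.reg r = s'.reg r) → e.eval s = e.eval s'
  | const _, _ => rfl
  | var x, h => h x (Nat.lt_succ_self x)
  | add a b, h => by
    simp only [bound, lt_max_iff] at h
    simp only [eval, eval_congr hm a fun r hr => h r (.inl hr),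
      eval_congr hm b fun r hr => h r (.inr hr)]
  | sub a b, h => by
    simp only [bound, lt_max_iff] at h
    simp only [eval, eval_congr hm a fun r hr => h r (.inl hr),
      eval_congr hm b fun r hr => h r (.inr hr)]
  | mul a b, h => by
    have h0 := h 0 (one_le_bound (.mul a b))
    simp only [bound, lt_max_iff] at h
    simp only [eval, eval_congr hm a fun r hr => h r (.inl hr),
      eval_congr hm b fun r hr => h r (.inr hr), h0]
  | load a, h => by
    simp only [eval, eval_congr hm a h, hm]

theorem exec_mul_loop (d : ℕ) : ∀ (c : ℕ) (s : State), s.reg d = c → s.reg (d + 3) = 1 →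
    ∃ s', Exec (.loop d (.seq (.instr (.add (d + 2) (d + 2) (d + 1)))
        (.instr (.sub d d (d + 3))))) s (3 * c + 1) s' ∧
      s'.reg (d + 2) = s.reg (d + 2) + c * s.reg (d + 1) ∧
      (∀ r < d, s'.reg r = s.reg r) ∧ s'.mem = s.mem := by
  intro c
  induction c with
  | zero =>
    intro s hc _
    exact ⟨s, .loop_false hc, by simp, fun _ _ => rfl, rfl⟩
  | succ c ih =>
    intro s hc h1
    obtain ⟨s', hs', h2, hr, hm⟩ := ih
      ((Instr.sub d d (d + 3)).apply ((Instr.add (d + 2) (d + 2) (d + 1)).apply s))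
      (by simp [Instr.apply, hc, h1]) (by simp [Instr.apply, h1])
    refine ⟨s', ?_, ?_, ?_, ?_⟩
    · have := Exec.loop_true (by omega) (.seq (.instr _ s) (.instr _ _)) hs'
      convert this using 1
      ring
    · rw [h2]
      simp [Instr.apply]
      ring
    · intro r hrd
      rw [hr r hrd]
      simp [Instr.apply, Function.update_of_ne (show r ≠ d by omega),
        Function.update_of_ne (show r ≠ d + 2 by omega)]
    · rw [hm]; rfl

/-- The compiled form of `e` works: it puts the value of `e` into the target register, within the
time bound, and leaves the lower registers and the memory alone. -/
def Correct (e : Expr) : Prop :=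
  ∀ (d : ℕ) (s : State), e.bound ≤ d →
    ∃ t s', Exec (e.compile d) s t s' ∧ t ≤ e.time.eval (s.reg 0) ∧ s'.reg d = e.eval s ∧
      (∀ r < d, s'.reg r = s.reg r) ∧ s'.mem = s.mem

theorem Correct.pair {a b : Expr} (hca : a.Correct) (hcb : b.Correct) (d : ℕ) (s : State)
    (h : max a.bound b.bound ≤ d) :
    ∃ t s', Exec (a.compile d) s t s' ∧ t ≤ a.time.eval (s.reg 0) ∧ s'.reg d = a.eval s ∧
      (∀ r < d, s'.reg r = s.reg r) ∧ s'.mem = s.mem ∧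
    ∃ t' s'', Exec (b.compile (d + 1)) s' t' s'' ∧ t' ≤ b.time.eval (s.reg 0) ∧
      s''.reg (d + 1) = b.eval s ∧ (∀ r < d + 1, s''.reg r = s'.reg r) ∧ s''.mem = s'.mem := by
  obtain ⟨ha, hb⟩ := max_le_iff.1 h
  obtain ⟨t, s', hx, ht, hv, hr, hm⟩ := hca d s ha
  obtain ⟨t', s'', hx', ht', hv', hr', hm'⟩ := hcb (d + 1) s' (by omega)
  refine ⟨t, s', hx, ht, hv, hr, hm, t', s'', hx', ?_, ?_, hr', hm'⟩
  · rwa [hr 0 (b.one_le_bound.trans hb)] at ht'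
  · rw [hv']
    exact eval_congr hm b fun r hrb => hr r (hrb.trans_le hb)

theorem correct : ∀ e : Expr, e.Correct
  | const c, d, s, _ => ⟨1, _, .instr _ _, by simp [time], by simp [Instr.apply, eval],
      fun r hr => by simp [Instr.apply, hr.ne], rfl⟩
  | var x, d, s, _ => ⟨1, _, .instr _ _, by simp [time], by simp [Instr.apply, eval],
      fun r hr => by simp [Instr.apply, hr.ne], rfl⟩
  | load a, d, s, h => by
    obtain ⟨t, s', hx, ht, hv, hr, hm⟩ := (correct a) d s h
    refine ⟨_, _, .seq hx (.instr _ _), ?_, ?_, ?_, ?_⟩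
    · simp [time, ht]
    · simp [Instr.apply, hv, eval, hm]
    · intro r hrd
      simp [Instr.apply, hrd.ne, hr r hrd]
    · simp [Instr.apply, hm]
  | add a b, d, s, h => by
    obtain ⟨t, s', hx, ht, hv, hr, hm, t', s'', hx', ht', hv', hr', hm'⟩ :=
      (correct a).pair (correct b) d s h
    refine ⟨_, _, .seq hx (.seq hx' (.instr _ _)), ?_, ?_, ?_, ?_⟩
    · simp only [time, Polynomial.eval_add, Polynomial.eval_one]; omega
    · simp [Instr.apply, hv', hr', hv, eval]
    · intro r hrd
      simp [Instr.apply, hrd.ne, hr r hrd, hr' r (by omega)]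
    · simp [Instr.apply, hm, hm']
  | sub a b, d, s, h => by
    obtain ⟨t, s', hx, ht, hv, hr, hm, t', s'', hx', ht', hv', hr', hm'⟩ :=
      (correct a).pair (correct b) d s h
    refine ⟨_, _, .seq hx (.seq hx' (.instr _ _)), ?_, ?_, ?_, ?_⟩
    · simp only [time, Polynomial.eval_add, Polynomial.eval_one]; omega
    · simp [Instr.apply, hv', hr', hv, eval]
    · intro r hrd
      simp [Instr.apply, hrd.ne, hr r hrd, hr' r (by omega)]
    · simp [Instr.apply, hm, hm']
  | mul a b, d, s, h => by
    have hd : 1 ≤ d := (one_le_bound _).trans h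
    obtain ⟨t, s', hx, ht, hv, hr, hm, t', s'', hx', ht', hv', hr', hm'⟩ :=
      (correct a).pair (correct b) d s h
    have h0 : s''.reg 0 = s.reg 0 := by rw [hr' 0 (by omega), hr 0 (by omega)]
    have hvd : s''.reg d = a.eval s := by rw [hr' d (by omega), hv]
    obtain ⟨s₃, hx₃, hv₃, hr₃, hm₃⟩ := exec_mul_loop d (min (a.eval s) (s.reg 0))
      ((Instr.const (d + 3) 1).apply ((Instr.const (d + 2) 0).apply
        ((Instr.sub d d (d + 2)).apply ((Instr.sub (d + 2) d 0).apply s''))))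
      (by simp [Instr.apply, Function.update_of_ne, hvd, h0]; omega) (by simp [Instr.apply])
    refine ⟨_, _, .seq hx (.seq hx' (.seq (.instr _ _) (.seq (.instr _ _) (.seq (.instr _ _)
      (.seq (.instr _ _) (.seq hx₃ (.instr _ _))))))), ?_, ?_, ?_, ?_⟩
    · simp only [time, Polynomial.eval_add, Polynomial.eval_mul, Polynomial.eval_X,
        Polynomial.eval_ofNat]
      have := Nat.min_le_right (a.eval s) (s.reg 0)
      omega
    · simp [Instr.apply, hv₃, hv', eval]
    · intro r hrd
      simp [Instr.apply, hrd.ne, hr₃ r hrd, hr r hrd, hr' r (by omega),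
        (show r ≠ d + 2 by omega), (show r ≠ d + 3 by omega)]
    · simp [Instr.apply, hm, hm', hm₃]

end Expr

/-- Programs with assignments, stores, and loops `for x < N do p`, where `N` is the content of
register `0`. -/
inductive Stmt where
  | assign (x : ℕ) (e : Expr)
  | store (a e : Expr)
  | seq (p q : Stmt)
  | loop (x : ℕ) (p : Stmt)

namespace Stmt

/-- The state after a program has been run. -/
def run : Stmt → State → State
  | assign x e, s => s.set x (e.eval s)
  | store a e, s => { s with mem := Function.update s.mem (a.eval s) (e.eval s) }
  | seq p q, s => q.run (p.run s)
  | loop x p, s => Nat.rec s (fun j s' => p.run (s'.set x j)) (s.reg 0)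

/-- Register `0`, which bounds all loops, is never written. -/
def Wf : Stmt → Prop
  | assign x _ => x ≠ 0
  | store _ _ => True
  | seq p q => p.Wf ∧ q.Wf
  | loop x p => x ≠ 0 ∧ p.Wf

/-- A strict upper bound for the registers that a program uses. -/
def bound : Stmt → ℕ
  | assign x e => max (x + 1) e.bound
  | store a e => max a.bound e.bound
  | seq p q => max p.bound q.bound
  | loop x p => max (x + 1) p.bound

/-- The translation into a program of the machine; registers from `d` on serve as scratch space. A
loop counts register `d` down from `N`, and recovers the loop variable by subtraction from `N`. -/
def compile : Stmt → ℕ → Prog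
  | assign x e, d => .seq (e.compile d) (.instr (.copy x d))
  | store a e, d => .seq (a.compile d) (.seq (e.compile (d + 1)) (.instr (.store d (d + 1))))
  | seq p q, d => .seq (p.compile d) (q.compile d)
  | loop x p, d => .seq (.instr (.copy d 0)) (.loop d (.seq (.instr (.sub x 0 d))
      (.seq (p.compile (d + 1)) (.seq (.instr (.const (d + 1) 1)) (.instr (.sub d d (d + 1)))))))

open Polynomial in
/-- A bound for the number of steps of the compiled program, in terms of register `0`. -/
noncomputable def time : Stmt → Polynomial ℕ
  | assign _ e => e.time + 1
  | store a e => a.time + e.time + 1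
  | seq p q => p.time + q.time
  | loop _ p => X * (p.time + 4) + 2

theorem run_reg_zero : ∀ (p : Stmt), p.Wf → ∀ s : State, (p.run s).reg 0 = s.reg 0
  | assign _ _, h, s => State.set_reg_of_ne s _ (Ne.symm h)
  | store _ _, _, _ => rfl
  | seq p q, h, s => by rw [run, run_reg_zero q h.2, run_reg_zero p h.1]
  | loop x p, h, s => by
    have key : ∀ N, (Nat.rec s (fun j s' => p.run (s'.set x j)) N : State).reg 0 = s.reg 0 := by
      intro N
      induction N with
      | zero => rfl
      | succ j ih => rw [← ih, run_reg_zero p h.2, State.set_reg_of_ne _ _ (Ne.symm h.1)]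
    exact key _

/-- The compiled program simulates `run` on the registers below `b`, provided that its scratch
space starts at some `d ≥ b`; scratch registers of enclosing loops, between `b` and `d`, are left
alone. -/
theorem exec_compile : ∀ (p : Stmt), p.Wf → ∀ (b d : ℕ) (s σ : State), p.bound ≤ b → b ≤ d →
    s.mem = σ.mem → (∀ r < b, s.reg r = σ.reg r) →
    ∃ t s', Exec (p.compile d) s t s' ∧ t ≤ p.time.eval (σ.reg 0) ∧
      s'.mem = (p.run σ).mem ∧ (∀ r < b, s'.reg r = (p.run σ).reg r) ∧
      ∀ r, b ≤ r → r < d → s'.reg r = s.reg r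
  | assign x e, _, b, d, s, σ, hb, hd, hm, hr => by
    obtain ⟨hxb, heb⟩ := max_le_iff.1 hb
    have h1 := e.one_le_bound
    obtain ⟨t, s', hx, ht, hv, hr', hm'⟩ := e.correct d s (heb.trans hd)
    have he : e.eval s = e.eval σ := Expr.eval_congr hm e fun r h => hr r (h.trans_le heb)
    refine ⟨_, _, .seq hx (.instr _ _), ?_, ?_, ?_, ?_⟩
    · rw [hr 0 (by omega)] at ht
      simp [time, ht]
    · simp [Instr.apply, run, hm', hm]
    · intro r hrb
      by_cases hrx : r = x
      · subst hrx
        simp [Instr.apply, run, hv, he]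
      · simp [Instr.apply, run, State.set, hrx, hr' r (by omega), hr r hrb]
    · intro r hbr hrd
      simp [Instr.apply, show r ≠ x by omega, hr' r hrd]
  | store a e, _, b, d, s, σ, hb, hd, hm, hr => by
    have h1 := e.one_le_bound
    have hbb : max a.bound e.bound ≤ b := hb
    obtain ⟨hab, heb⟩ := max_le_iff.1 hbb
    obtain ⟨t, s', hx, ht, hv, hr', hm', t', s'', hx', ht', hv', hr'', hm''⟩ :=
      a.correct.pair e.correct d s (hbb.trans hd)
    have ha : a.eval s = a.eval σ := Expr.eval_congr hm a fun r h => hr r (h.trans_le hab)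
    have he : e.eval s = e.eval σ := Expr.eval_congr hm e fun r h => hr r (h.trans_le heb)
    refine ⟨_, _, .seq hx (.seq hx' (.instr _ _)), ?_, ?_, ?_, ?_⟩
    · rw [hr 0 (by omega)] at ht ht'
      simp only [time, Polynomial.eval_add, Polynomial.eval_one]
      omega
    · simp [Instr.apply, run, hv', hr'', hv, hm', hm'', hm, ha, he]
    · intro r hrb
      simp [Instr.apply, run, hr'' r (by omega), hr' r (by omega), hr r hrb]
    · intro r hbr hrd
      simp [Instr.apply, hr'' r (by omega), hr' r (by omega)]
  | seq p q, h, b, d, s, σ, hb, hd, hm, hr => by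
    obtain ⟨hpb, hqb⟩ := max_le_iff.1 hb
    obtain ⟨t, s', hx, ht, hm', hr', hs'⟩ := exec_compile p h.1 b d s σ hpb hd hm hr
    obtain ⟨t', s'', hx', ht', hm'', hr'', hs''⟩ := exec_compile q h.2 b d s' _ hqb hd hm' hr'
    refine ⟨_, _, .seq hx hx', ?_, hm'', hr'', fun r h1 h2 => by rw [hs'' r h1 h2, hs' r h1 h2]⟩
    rw [run_reg_zero p h.1] at ht'
    simp only [time, Polynomial.eval_add]
    omega
  | loop x p, h, b, d, s, σ, hb, hd, hm, hr => by
    obtain ⟨hxb, hpb⟩ := max_le_iff.1 hb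
    have h0 : s.reg 0 = σ.reg 0 := hr 0 (by omega)
    set N := σ.reg 0 with hN
    let it : ℕ → State := fun j => Nat.rec σ (fun j s' => p.run (s'.set x j)) j
    have hit0 : ∀ j, (it j).reg 0 = N := by
      intro j
      induction j with
      | zero => rfl
      | succ j ih =>
        change (p.run ((it j).set x j)).reg 0 = N
        rw [run_reg_zero p h.2, State.set_reg_of_ne _ _ (Ne.symm h.1), ih]
    -- The loop is entered for the `j`-th time with `c = N - j` in the counter.
    have key : ∀ (c j : ℕ) (s : State), j + c = N → s.reg d = c → s.mem = (it j).mem →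
        (∀ r < b, s.reg r = (it j).reg r) →
        ∃ t s', Exec (.loop d (.seq (.instr (.sub x 0 d)) (.seq (p.compile (d + 1))
            (.seq (.instr (.const (d + 1) 1)) (.instr (.sub d d (d + 1))))))) s t s' ∧
          t ≤ c * (p.time.eval N + 4) + 1 ∧ s'.mem = (it N).mem ∧
          (∀ r < b, s'.reg r = (it N).reg r) ∧ ∀ r, b ≤ r → r < d → s'.reg r = s.reg r := by
      intro c
      induction c with
      | zero =>
        intro j s hj hc hm hr
        obtain rfl : j = N := by omega
        exact ⟨1, s, .loop_false hc, by simp, hm, hr, fun _ _ _ => rfl⟩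
      | succ c ih =>
        intro j s hj hc hm hr
        have hs0 : s.reg 0 = N := by rw [hr 0 (by omega), hit0]
        obtain ⟨t, s₁, hx₁, ht₁, hm₁, hr₁, hs₁⟩ := exec_compile p h.2 b (d + 1)
          ((Instr.sub x 0 d).apply s) ((it j).set x j) hpb (by omega) hm (by
            intro r hrb
            by_cases hrx : r = x
            · subst hrx
              simp only [Instr.apply, Function.update_self, hc, hs0, State.set_reg_self]
              omega
            · simp [Instr.apply, State.set, hrx, hr r hrb])
        rw [State.set_reg_of_ne _ _ (Ne.symm h.1), hit0] at ht₁
        have hd₁ : s₁.reg d = c + 1 := by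
          rw [hs₁ d hd (by omega)]
          simp [Instr.apply, show d ≠ x by omega, hc]
        obtain ⟨t₂, s₂, hx₂, ht₂, hm₂, hr₂, hs₂⟩ := ih (j + 1)
          ((Instr.sub d d (d + 1)).apply ((Instr.const (d + 1) 1).apply s₁)) (by omega)
          (by simp [Instr.apply, hd₁]) hm₁ (by
            intro r hrb
            simp only [Instr.apply, Function.update_of_ne (show r ≠ d by omega),
              Function.update_of_ne (show r ≠ d + 1 by omega)]
            exact hr₁ r hrb)
        refine ⟨_, s₂, .loop_true (by omega) (.seq (.instr _ _) (.seq hx₁ (.seq (.instr _ _)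
          (.instr _ _)))) hx₂, ?_, hm₂, hr₂, ?_⟩
        · rw [Nat.succ_mul]
          omega
        · intro r hbr hrd
          rw [hs₂ r hbr hrd]
          simp only [Instr.apply, Function.update_of_ne (show r ≠ d by omega),
              Function.update_of_ne (show r ≠ d + 1 by omega)]
          rw [hs₁ r hbr (by omega)]
          simp [Instr.apply, show r ≠ x by omega]
    obtain ⟨t, s', hx, ht, hm', hr', hs'⟩ := key N 0 ((Instr.copy d 0).apply s) (by omega)
      (by simp [Instr.apply, h0]) hm (by
        intro r hrb
        simp only [Instr.apply, Function.update_of_ne (show r ≠ d by omega)]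
        exact hr r hrb)
    refine ⟨_, s', .seq (.instr _ _) hx, ?_, hm', hr', ?_⟩
    · simp only [time, Polynomial.eval_add, Polynomial.eval_mul, Polynomial.eval_X,
        Polynomial.eval_ofNat]
      omega
    · intro r hbr hrd
      rw [hs' r hbr hrd]
      simp [Instr.apply, show r ≠ d by omega]

/-- A problem is solvable in polynomial time if some program of the loop language leaves a nonzero
number in register `x` exactly on the yes-instances. -/
theorem solvableInPolyTime {I : Type} {enc : I → List Bool} {Yes : I → Prop} (p : Stmt)
    (hp : p.Wf) (x : ℕ) (h : ∀ i, (p.run (init (enc i))).reg x ≠ 0 ↔ Yes i) :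
    SolvableInPolyTime enc Yes := by
  -- `1 - (1 - a)` replaces a nonzero `a` by `1`.
  let q : Stmt := .seq p (.assign (x + 1) (.sub (.const 1) (.sub (.const 1) (.var x))))
  have hq : q.Wf := ⟨hp, x.succ_ne_zero⟩
  refine ⟨.seq (q.compile q.bound) (.instr (.copy 0 (x + 1))), q.time + 1, fun i => ?_⟩
  obtain ⟨t, s, hx, ht, -, hr, -⟩ := exec_compile q hq _ _ (init (enc i)) _ le_rfl le_rfl rfl
    fun _ _ => rfl
  refine ⟨_, _, .seq hx (.instr _ _), ?_, ?_⟩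
  · simpa [init] using ht
  · have hout : s.reg (x + 1) = 1 - (1 - (p.run (init (enc i))).reg x) := by
      rw [hr (x + 1) (by simp [q, bound])]
      simp [q, run, Expr.eval]
    have := h i
    simp only [Instr.apply, Function.update_self, hout]
    constructor
    · intro hy
      have := this.2 hy
      omega
    · intro hy
      have := mt this.1 hy
      omega

end Stmt

end RAM

/-! ### Sweeping over the vertices -/

namespace Sweep

/-- Entry `j` of the block of color `i` in the state `y`. Each block has `3 * m` entries: the `m`
most recent vertices of color `i` (the window, latest vertex first), then a guess for the first `m`
vertices of color `i`, then a guess for its last `m` vertices. An entry that is not a vertex stands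
for a missing one. -/
def slot (m : ℕ) (y : ℕ → ℕ) (i j : ℕ) : ℕ := y (i * (3 * m) + j)

/-- The state after vertex `v` has received color `i`: the vertex is pushed into the window. -/
def shift (m i v : ℕ) (y : ℕ → ℕ) (p : ℕ) : ℕ :=
  if p / (3 * m) = i ∧ p % (3 * m) < m then if p % (3 * m) = 0 then v else y (p - 1) else y p

/-- The guess for color `i` permits that vertex `v` gets this color: the guessed vertices are
pairwise nonadjacent and not adjacent to `v`, and `v` is one of them or it lies after `m` of them
and before `m` of them. Adjacency is given by `A`, and the vertices are the numbers below `n`. -/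
def Guess (n m : ℕ) (A : ℕ → ℕ → Prop) (y : ℕ → ℕ) (v i : ℕ) : Prop :=
  (∀ j < 2 * m, slot m y i (m + j) < n → ¬ A v (slot m y i (m + j))) ∧
  (∀ j < 2 * m, ∀ j' < 2 * m, slot m y i (m + j) < n → slot m y i (m + j') < n →
    ¬ A (slot m y i (m + j)) (slot m y i (m + j'))) ∧
  ((∃ j < 2 * m, slot m y i (m + j) = v) ∨
    ∀ j < m, slot m y i (m + j) < v ∧ v < slot m y i (2 * m + j) ∧ slot m y i (2 * m + j) < n ∧
      ∀ j' < j, slot m y i (m + j') < slot m y i (m + j) ∧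
        slot m y i (2 * m + j') < slot m y i (2 * m + j))

/-- The sweep succeeds from state `y` on, when the last `t` of the `n` vertices are still to be
colored. -/
def Cell (n m k : ℕ) (A L : ℕ → ℕ → Prop) : ℕ → (ℕ → ℕ) → Prop
  | 0, _ => True
  | t + 1, y => ∃ i < k, L (n - (t + 1)) i ∧
      (∀ j < m, slot m y i j < n → ¬ A (n - (t + 1)) (slot m y i j)) ∧
      Guess n m A y (n - (t + 1)) i ∧ Cell n m k A L t (shift m i (n - (t + 1)) y)

section Slots

variable {m i j v i' : ℕ} {y : ℕ → ℕ}

theorem slot_shift_zero (hm : 0 < m) : slot m (shift m i v y) i 0 = v := by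
  simp [slot, shift, hm]

theorem slot_shift_succ (hj : j + 1 < m) :
    slot m (shift m i v y) i (j + 1) = slot m y i j := by
  have h1 : (i * (3 * m) + (j + 1)) / (3 * m) = i := by
    rw [mul_comm, Nat.mul_add_div (by omega), Nat.div_eq_of_lt (by omega), add_zero]
  have h2 : (i * (3 * m) + (j + 1)) % (3 * m) = j + 1 := by
    rw [mul_comm, Nat.mul_add_mod, Nat.mod_eq_of_lt (by omega)]
  simp only [slot, shift, h1, h2, hj, and_self, if_true, j.succ_ne_zero, if_false]
  rfl

theorem slot_shift_of_ne (h : i' ≠ i) (hj : j < 3 * m) :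
    slot m (shift m i v y) i' j = slot m y i' j := by
  have h1 : (i' * (3 * m) + j) / (3 * m) = i' := by
    rw [mul_comm, Nat.mul_add_div (by omega), Nat.div_eq_of_lt (by omega), add_zero]
  simp [slot, shift, h1, h]

theorem slot_shift_guess (hj : j < 2 * m) :
    slot m (shift m i v y) i' (m + j) = slot m y i' (m + j) := by
  have h2 : (i' * (3 * m) + (m + j)) % (3 * m) = m + j := by
    rw [mul_comm, Nat.mul_add_mod, Nat.mod_eq_of_lt (by omega)]
  simp [slot, shift, h2]

end Slots

theorem Guess.congr {n m : ℕ} {A : ℕ → ℕ → Prop} {y y' : ℕ → ℕ} {v i : ℕ}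
    (h : ∀ j < 2 * m, slot m y i (m + j) = slot m y' i (m + j)) (hg : Guess n m A y v i) :
    Guess n m A y' v i := by
  obtain ⟨h1, h2, h3⟩ := hg
  refine ⟨fun j hj => h j hj ▸ h1 j hj, fun j hj j' hj' => h j hj ▸ h j' hj' ▸ h2 j hj j' hj', ?_⟩
  refine h3.imp (fun ⟨j, hj, hv⟩ => ⟨j, hj, h j hj ▸ hv⟩) fun h3 j hj => ?_
  have e1 : ∀ j < m, slot m y i (m + j) = slot m y' i (m + j) := fun j hj => h j (by omega)
  have e2 : ∀ j < m, slot m y i (2 * m + j) = slot m y' i (2 * m + j) := fun j hj => by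
    have := h (m + j) (by omega)
    rwa [← add_assoc, ← two_mul] at this
  obtain ⟨a, b, c, d⟩ := h3 j hj
  refine ⟨e1 j hj ▸ a, e2 j hj ▸ b, e2 j hj ▸ c, fun j' hj' => ?_⟩
  rw [← e1 j hj, ← e2 j hj, ← e1 j' (by omega), ← e2 j' (by omega)]
  exact d j' hj'

/-- A successful sweep colors the vertices so that two adjacent vertices of the same color always
have `m` vertices of this color between them: the windows catch all closer conflicts. -/
theorem Cell.exists_coloring {n m k : ℕ} {A L : ℕ → ℕ → Prop} (hm : 0 < m) {y₀ : ℕ → ℕ}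
    (h : Cell n m k A L n y₀) : ∀ s ≤ n, ∃ c y : ℕ → ℕ, Cell n m k A L (n - s) y ∧
      (∀ i, ∀ j < 2 * m, slot m y i (m + j) = slot m y₀ i (m + j)) ∧
      (∀ v < s, c v < k ∧ L v (c v) ∧ Guess n m A y₀ v (c v)) ∧
      (∀ u < s, ∃ j ≤ m, (j < m → slot m y (c u) j = u) ∧ ∀ j' < j, u < slot m y (c u) j' ∧
        slot m y (c u) j' < s ∧ c (slot m y (c u) j') = c u ∧
        ∀ j'' < j', slot m y (c u) j' < slot m y (c u) j'') ∧
      (∀ v < s, ∀ u < v, c u = c v → A v u → ∃ w : ℕ → ℕ, ∀ j < m, u < w j ∧ w j < v ∧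
        c (w j) = c u ∧ ∀ j' < j, w j < w j') := by
  intro s
  induction s with
  | zero => exact fun _ => ⟨fun _ => 0, y₀, h, by simp⟩
  | succ s ih =>
    intro hs
    obtain ⟨c, y, hy, hF, hc, hw, hconf⟩ := ih (by omega)
    obtain ⟨t, ht⟩ : ∃ t, n - s = t + 1 := ⟨n - s - 1, by omega⟩
    rw [ht] at hy
    obtain ⟨i, hi, hL, hA, hG, hy'⟩ := hy
    obtain rfl : s = n - (t + 1) := by omega
    set s := n - (t + 1)
    have hold : ∀ u < s, Function.update c s i u = c u := fun u hu => by
      rw [Function.update_of_ne (by omega)]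
    refine ⟨Function.update c s i, shift m i s y, ?_, ?_, ?_, ?_, ?_⟩
    · rwa [show n - (s + 1) = t by omega]
    · exact fun i' j hj => by rw [slot_shift_guess hj, hF i' j hj]
    · intro v hv
      rcases Nat.lt_succ_iff_lt_or_eq.1 hv with hv | rfl
      · rw [hold v hv]; exact hc v hv
      · rw [Function.update_self]
        exact ⟨hi, hL, hG.congr (hF i)⟩
    · intro u hu
      rcases Nat.lt_succ_iff_lt_or_eq.1 hu with hu | rfl
      · rw [hold u hu]
        obtain ⟨j, hjm, hj, hch⟩ := hw u hu
        by_cases hci : c u = i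
        · subst hci
          refine ⟨min (j + 1) m, min_le_right _ _, ?_, ?_⟩
          · intro hlt
            have hlt' : j + 1 < m := by omega
            rw [min_eq_left hlt'.le, slot_shift_succ hlt']
            exact hj (by omega)
          · intro j' hj'
            rcases j' with _ | j'
            · rw [slot_shift_zero hm]
              exact ⟨hu, s.lt_succ_self, Function.update_self .., by simp⟩
            · have hj'm : j' + 1 < m := by omega
              obtain ⟨h1, h2, h3, h4⟩ := hch j' (by omega)
              rw [slot_shift_succ hj'm]
              refine ⟨h1, by omega, by rw [hold _ h2, h3], ?_⟩
              rintro (_ | j'') hj''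
              · rwa [slot_shift_zero hm]
              · rw [slot_shift_succ (by omega)]
                exact h4 j'' (by omega)
        · refine ⟨j, hjm, fun hlt => ?_, fun j' hj' => ?_⟩
          · rw [slot_shift_of_ne hci (by omega)]
            exact hj hlt
          · obtain ⟨h1, h2, h3, h4⟩ := hch j' hj'
            rw [slot_shift_of_ne hci (by omega)]
            refine ⟨h1, by omega, by rw [hold _ h2, h3], fun j'' hj'' => ?_⟩
            rw [slot_shift_of_ne hci (by omega)]
            exact h4 j'' hj''
      · rw [Function.update_self]
        exact ⟨0, hm.le, fun _ => slot_shift_zero hm, by simp⟩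
    · intro v hv u hu hcol hadj
      rcases Nat.lt_succ_iff_lt_or_eq.1 hv with hv | rfl
      · rw [hold u (by omega), hold v hv] at hcol
        obtain ⟨w, hw⟩ := hconf v hv u hu hcol hadj
        refine ⟨w, fun j hj => ?_⟩
        obtain ⟨h1, h2, h3, h4⟩ := hw j hj
        rw [hold u (by omega), hold (w j) (by omega)]
        exact ⟨h1, h2, h3, h4⟩
      · rw [hold u hu, Function.update_self] at hcol
        subst hcol
        obtain ⟨j, hjm, hj, hch⟩ := hw u hu
        obtain rfl : j = m := by
          by_contra hne
          have hlt : j < m := by omega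
          refine hA j hlt ?_ ?_ <;> rw [hj hlt]
          · omega
          · exact hadj
        refine ⟨slot j y (c u), fun j' hj' => ?_⟩
        obtain ⟨h1, h2, h3, h4⟩ := hch j' hj'
        rw [hold u hu, hold _ h2]
        exact ⟨h1, h2, h3, h4⟩

open Classical in
/-- The vertices of color `i` below `s` in the coloring `c`, latest first. -/
noncomputable def hist (c : ℕ → ℕ) (i : ℕ) : ℕ → List ℕ
  | 0 => []
  | s + 1 => if c s = i then s :: hist c i s else hist c i s

theorem mem_hist {c : ℕ → ℕ} {i s v : ℕ} : v ∈ hist c i s ↔ v < s ∧ c v = i := by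
  induction s with
  | zero => simp [hist]
  | succ s ih =>
    rw [hist]
    split_ifs with h
    · rw [List.mem_cons, ih]
      constructor
      · rintro (rfl | ⟨h1, h2⟩)
        · exact ⟨v.lt_succ_self, h⟩
        · exact ⟨by omega, h2⟩
      · rintro ⟨h1, h2⟩
        rcases Nat.lt_succ_iff_lt_or_eq.1 h1 with h1 | h1
        · exact .inr ⟨h1, h2⟩
        · exact .inl h1
    · rw [ih]
      constructor
      · exact fun ⟨h1, h2⟩ => ⟨by omega, h2⟩
      · rintro ⟨h1, h2⟩
        have : v ≠ s := by rintro rfl; exact h h2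
        exact ⟨by omega, h2⟩

theorem sorted_hist (c : ℕ → ℕ) (i s : ℕ) : (hist c i s).reverse.Pairwise (· < ·) := by
  rw [List.pairwise_reverse]
  induction s with
  | zero => simp [hist]
  | succ s ih =>
    rw [hist]
    split_ifs
    · exact List.pairwise_cons.2 ⟨fun v hv => (mem_hist.1 hv).1, ih⟩
    · exact ih

theorem getD_lt_or_mem {l : List ℕ} {j n : ℕ} : l.getD j n = n ∨ l.getD j n ∈ l := by
  by_cases h : j < l.length
  · right
    rw [List.getD_eq_getElem _ _ h]
    exact List.getElem_mem h
  · left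
    exact List.getD_eq_default _ _ (by omega)

/-- The state of the sweep along a coloring `c` when the vertices below `s` are colored. The guess
for a color consists of the first `m` and the last `m` vertices of the color; if there are fewer
than `2 * m` of them, then the two parts together list them all. -/
noncomputable def stateAt (n m : ℕ) (c : ℕ → ℕ) (s p : ℕ) : ℕ :=
  let i := p / (3 * m)
  let j := p % (3 * m)
  let l := (hist c i n).reverse
  if j < m then (hist c i s).getD j n
  else if j < 2 * m then l.getD (j - m) n
  else l.getD (max m (l.length - m) + (j - 2 * m)) n

theorem stateAt_le (n m : ℕ) (c : ℕ → ℕ) {s : ℕ} (hs : s ≤ n) (p : ℕ) :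
    stateAt n m c s p ≤ n := by
  have key : ∀ (l : List ℕ) (j : ℕ), (∀ v ∈ l, v < n) → l.getD j n ≤ n := fun l j hl =>
    (getD_lt_or_mem (l := l) (j := j) (n := n)).elim (fun h => h.le) fun h => (hl _ h).le
  have hr : ∀ v ∈ (hist c (p / (3 * m)) n).reverse, v < n := fun v hv =>
    (mem_hist.1 (List.mem_reverse.1 hv)).1
  simp only [stateAt]
  split_ifs
  · exact key _ _ fun v hv => (mem_hist.1 hv).1.trans_le hs
  · exact key _ _ hr
  · exact key _ _ hr

theorem slot_stateAt {n m : ℕ} {c : ℕ → ℕ} {s i j : ℕ} (hj : j < 3 * m) :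
    slot m (stateAt n m c s) i j = if j < m then (hist c i s).getD j n
      else if j < 2 * m then (hist c i n).reverse.getD (j - m) n
      else (hist c i n).reverse.getD (max m ((hist c i n).reverse.length - m) + (j - 2 * m)) n := by
  have h1 : (i * (3 * m) + j) / (3 * m) = i := by
    rw [mul_comm, Nat.mul_add_div (by omega), Nat.div_eq_of_lt (by omega), add_zero]
  have h2 : (i * (3 * m) + j) % (3 * m) = j := by
    rw [mul_comm, Nat.mul_add_mod, Nat.mod_eq_of_lt (by omega)]
  simp only [slot, stateAt, h1, h2]

theorem shift_stateAt {n m : ℕ} (hm : 0 < m) {c : ℕ → ℕ} {s : ℕ} :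
    shift m (c s) s (stateAt n m c s) = stateAt n m c (s + 1) := by
  funext p
  rw [shift]
  split_ifs with h h0
  · simp [stateAt, h.1, h0, hm, hist]
  · obtain ⟨q, rfl⟩ : ∃ q, p = q + 1 := ⟨p - 1, by
      have : p ≠ 0 := by rintro rfl; simp at h0
      omega⟩
    have hd := Nat.div_add_mod (q + 1) (3 * m)
    obtain ⟨r, hr⟩ : ∃ r, (q + 1) % (3 * m) = r + 1 := ⟨(q + 1) % (3 * m) - 1, by omega⟩
    have h1 : q / (3 * m) = c s := by
      rw [h.1, hr] at hd
      rw [show q = 3 * m * c s + r by omega, Nat.mul_add_div (by omega),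
        Nat.div_eq_of_lt (by omega), add_zero]
    have h2 : q % (3 * m) = r := by
      rw [h.1, hr] at hd
      rw [show q = 3 * m * c s + r by omega, Nat.mul_add_mod, Nat.mod_eq_of_lt (by omega)]
    have h3 := h.2
    rw [hr] at h3
    simp [stateAt, h.1, h1, h2, hr, h3, show r < m by omega, hist]
  · by_cases hi : p / (3 * m) = c s
    · have hj : ¬ p % (3 * m) < m := fun hj => h ⟨hi, hj⟩
      simp [stateAt, hj]
    · simp [stateAt, hist, Ne.symm hi]

theorem guess_stateAt {n m : ℕ} {A : ℕ → ℕ → Prop} {c : ℕ → ℕ}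
    (hA : ∀ u < n, ∀ v < n, A u v → c u ≠ c v) {v s : ℕ} (hv : v < n) :
    Guess n m A (stateAt n m c s) v (c v) := by
  set l := (hist c (c v) n).reverse with hl
  have hleft : ∀ j < m, slot m (stateAt n m c s) (c v) (m + j) = l.getD j n := fun j hj => by
    rw [slot_stateAt (by omega), if_neg (by omega), if_pos (by omega), Nat.add_sub_cancel_left]
  have hright : ∀ j < m, slot m (stateAt n m c s) (c v) (2 * m + j) =
      l.getD (max m (l.length - m) + j) n := fun j hj => by
    rw [slot_stateAt (by omega), if_neg (by omega), if_neg (by omega), Nat.add_sub_cancel_left]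
  have hmem : ∀ u, u ∈ l ↔ u < n ∧ c u = c v := fun u => by
    rw [hl, List.mem_reverse, mem_hist]
  have hcol : ∀ j < 2 * m, slot m (stateAt n m c s) (c v) (m + j) < n →
      c (slot m (stateAt n m c s) (c v) (m + j)) = c v := by
    intro j hj hlt
    by_cases hjm : j < m
    · rw [hleft j hjm] at hlt ⊢
      exact ((hmem _).1 (getD_lt_or_mem.resolve_left hlt.ne)).2
    · obtain ⟨j', rfl⟩ : ∃ j', j = m + j' := ⟨j - m, by omega⟩
      rw [← add_assoc, ← two_mul, hright j' (by omega)] at hlt ⊢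
      exact ((hmem _).1 (getD_lt_or_mem.resolve_left hlt.ne)).2
  refine ⟨fun j hj hlt hadj => hA _ hv _ hlt hadj (hcol j hj hlt).symm,
    fun j hj j' hj' hlt hlt' hadj => hA _ hlt _ hlt' hadj ?_, ?_⟩
  · rw [hcol j hj hlt, hcol j' hj' hlt']
  · obtain ⟨r, hr, hrv⟩ := List.mem_iff_getElem.1 ((hmem v).2 ⟨hv, rfl⟩)
    by_cases h1 : r < m
    · refine .inl ⟨r, by omega, ?_⟩
      rw [hleft r h1, List.getD_eq_getElem _ _ hr, hrv]
    by_cases h2 : max m (l.length - m) ≤ r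
    · refine .inl ⟨m + (r - max m (l.length - m)), by omega, ?_⟩
      rw [← add_assoc, ← two_mul, hright _ (by omega), Nat.add_sub_cancel' h2,
        List.getD_eq_getElem _ _ hr, hrv]
    right
    have hlen : m + m ≤ l.length := by omega
    have hmax : max m (l.length - m) = l.length - m := max_eq_right (by omega)
    have hsort := List.pairwise_iff_getElem.1 (sorted_hist c (c v) n)
    intro j hj
    rw [hleft j hj, hright j hj, hmax, List.getD_eq_getElem _ _ (show j < l.length by omega),
      List.getD_eq_getElem _ _ (show l.length - m + j < l.length by omega)]
    refine ⟨(hsort _ _ _ _ (by omega)).trans_eq hrv, hrv.symm.trans_lt (hsort _ _ _ _ (by omega)),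
      ((hmem _).1 (List.getElem_mem _)).1, fun j' hj' => ?_⟩
    rw [hleft j' (by omega), hright j' (by omega), hmax,
      List.getD_eq_getElem _ _ (show j' < l.length by omega),
      List.getD_eq_getElem _ _ (show l.length - m + j' < l.length by omega)]
    exact ⟨hsort _ _ _ _ (by omega), hsort _ _ _ _ (by omega)⟩

/-- The sweep succeeds along every proper list coloring. -/
theorem cell_stateAt {n m k : ℕ} {A L : ℕ → ℕ → Prop} (hm : 0 < m) {c : ℕ → ℕ}
    (hA : ∀ u < n, ∀ v < n, A u v → c u ≠ c v) (hL : ∀ v < n, c v < k ∧ L v (c v)) :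
    ∀ t ≤ n, Cell n m k A L t (stateAt n m c (n - t)) := by
  intro t
  induction t with
  | zero => exact fun _ => trivial
  | succ t ih =>
    intro ht
    set s := n - (t + 1) with hs
    have hsn : s < n := by omega
    refine ⟨c s, (hL s hsn).1, (hL s hsn).2, fun j hj hlt hadj => ?_, guess_stateAt hA hsn, ?_⟩
    · rw [slot_stateAt (by omega), if_pos hj] at hlt hadj
      exact hA _ hsn _ hlt hadj (mem_hist.1 (getD_lt_or_mem.resolve_left hlt.ne)).2.symm
    · rw [shift_stateAt hm, show s + 1 = n - t by omega]
      exact ih (by omega)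

/-! ### Conflicts contain the forbidden pattern -/

section Pattern

variable {V : Type*} [LinearOrder V]

theorem exists_edge_of_ncard_edgeSet_eq_one {H : SimpleGraph V} (hH : H.edgeSet.ncard = 1) :
    ∃ a b : V, a < b ∧ ∀ x y, x < y → (H.Adj x y ↔ x = a ∧ y = b) := by
  obtain ⟨e, he⟩ := Set.ncard_eq_one.1 hH
  have key : ∀ x y, H.Adj x y ↔ s(x, y) = e := fun x y => by
    rw [← SimpleGraph.mem_edgeSet, he, Set.mem_singleton_iff]
  induction e using Sym2.ind with
  | _ a b =>
    rcases lt_trichotomy a b with hab | hab | hab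
    · refine ⟨a, b, hab, fun x y hxy => ?_⟩
      rw [key, Sym2.eq_iff]
      refine ⟨?_, .inl⟩
      rintro (h | ⟨rfl, rfl⟩)
      · exact h
      · exact absurd hab hxy.asymm
    · exact absurd ((key a b).2 rfl) (hab ▸ H.irrefl)
    · refine ⟨b, a, hab, fun x y hxy => ?_⟩
      rw [key, Sym2.eq_iff]
      refine ⟨?_, fun h => .inr h⟩
      rintro (⟨rfl, rfl⟩ | h)
      · exact absurd hab hxy.asymm
      · exact h

/-- In a graph on `0, …, n - 1` that is free of a graph `H` with one edge, an edge `u v` cannot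
have an independent set around it that contains `m = |H|` vertices before `u`, between `u` and `v`,
and after `v`, none adjacent to `u` or `v`. -/
theorem not_orderedFree_of_conflict [Fintype V] {H : SimpleGraph V} {a b : V} (hab : a < b)
    (hH : ∀ x y, x < y → (H.Adj x y ↔ x = a ∧ y = b)) {n : ℕ} {G : SimpleGraph (Fin n)}
    {u v : Fin n} (huv : u < v) (hadj : G.Adj u v) (l w r : Fin (Fintype.card V) → Fin n)
    (hl : StrictMono l) (hw : StrictMono w) (hr : StrictMono r)
    (hlu : ∀ j, l j < u) (huw : ∀ j, u < w j) (hwv : ∀ j, w j < v) (hvr : ∀ j, v < r j)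
    (hind : ∀ x y, x ∈ Set.range l ∪ Set.range w ∪ Set.range r ∪ {u, v} →
      y ∈ Set.range l ∪ Set.range w ∪ Set.range r ∪ {u, v} → x < y → G.Adj x y → x = u ∧ y = v) :
    ¬ OrderedFree H G := by
  let e : V ≃o Fin (Fintype.card V) := (Fintype.orderIsoFinOfCardEq V rfl).symm
  let f : V → Fin n := fun x => if x < a then l (e x) else if x = a then u
    else if x < b then w (e x) else if x = b then v else r (e x)
  have hfa : f a = u := by simp [f]
  have hfb : f b = v := by simp [f, hab.asymm, hab.ne']
  have hf : StrictMono f := by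
    intro x y hxy
    have hexy : e x < e y := e.strictMono hxy
    have h1 : ∀ j j', l j < w j' := fun j j' => (hlu j).trans (huw j')
    have h2 : ∀ j j', w j < r j' := fun j j' => (hwv j).trans (hvr j')
    have h3 : ∀ j j', l j < r j' := fun j j' => (h1 j j').trans (h2 j' j')
    have h4 : ∀ j, l j < v := fun j => (hlu j).trans huv
    have h5 : ∀ j, u < r j := fun j => huv.trans (hvr j)
    simp only [f]
    split_ifs <;> first
      | exact hl hexy | exact hw hexy | exact hr hexy | exact hlu _ | exact huw _ | exact hwv _
      | exact hvr _ | exact h1 _ _ | exact h2 _ _ | exact h3 _ _ | exact h4 _ | exact h5 _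
      | exact huv
      | (exfalso; order)
  have hmem : ∀ x, f x ∈ Set.range l ∪ Set.range w ∪ Set.range r ∪ {u, v} := by
    intro x
    simp only [f]
    split_ifs <;> simp
  have hlt : ∀ x y, x < y → (G.Adj (f x) (f y) ↔ H.Adj x y) := by
    intro x y hxy
    rw [hH x y hxy]
    constructor
    · intro h
      obtain ⟨h1, h2⟩ := hind _ _ (hmem x) (hmem y) (hf hxy) h
      exact ⟨hf.injective (h1.trans hfa.symm), hf.injective (h2.trans hfb.symm)⟩
    · rintro ⟨rfl, rfl⟩
      rwa [hfa, hfb]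
  refine not_not.2 ⟨OrderEmbedding.ofStrictMono f hf, fun x y => ?_⟩
  simp only [OrderEmbedding.coe_ofStrictMono]
  rcases lt_trichotomy x y with h | rfl | h
  · exact hlt x y h
  · simp
  · rw [G.adj_comm, H.adj_comm, hlt y x h]

end Pattern

/-- If the sweep succeeds on an `H`-free graph, then there is a list coloring. A monochromatic edge
`u v` with `v - u` as small as possible would, together with the `m` vertices of its color that lie
between its ends and with the guess for its color, contain `H`. -/
theorem Cell.isYes {V : Type*} [Fintype V] [LinearOrder V] {H : SimpleGraph V}
    (hH : H.edgeSet.ncard = 1) {k : ℕ} (x : ListColInstance k) (hx : OrderedFree H x.G)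
    {A L : ℕ → ℕ → Prop} (hA : ∀ u v : Fin x.n, A u v ↔ x.G.Adj u v)
    (hL : ∀ (v : Fin x.n) (i : Fin k), L v i ↔ i ∈ x.L v) {y : ℕ → ℕ}
    (hy : Cell x.n (Fintype.card V) k A L x.n y) : x.IsYes := by
  obtain ⟨a, b, hab, hedge⟩ := exists_edge_of_ncard_edgeSet_eq_one hH
  set m := Fintype.card V
  have hm : 0 < m := Fintype.card_pos_iff.2 ⟨a⟩
  obtain ⟨c, -, -, -, hc, -, hconf⟩ := hy.exists_coloring hm x.n le_rfl
  have hproper : ∀ d (u v : Fin x.n), u < v → (v : ℕ) - u = d → c u = c v → ¬ A u v := by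
    intro d
    induction d using Nat.strong_induction_on with
    | _ d ih =>
      rintro u v huv rfl hcol hadj
      have hsymm : ∀ u v : Fin x.n, A u v → A v u := fun u v h => by
        rw [hA] at h ⊢; exact h.symm
      obtain ⟨w, hw⟩ := hconf v v.2 u huv hcol (hsymm _ _ hadj)
      obtain ⟨hu1, hu2, hu3⟩ := (hc u u.2).2.2
      obtain ⟨hv1, -, hv3⟩ := (hc v v.2).2.2
      rw [← hcol] at hv1 hv3
      -- The ends of the edge are not guessed themselves, for they are adjacent.
      replace hu3 := hu3.resolve_left fun ⟨j, hj, hju⟩ =>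
        hv1 j hj (hju.trans_lt u.2) (by rw [hju]; exact hsymm _ _ hadj)
      replace hv3 := hv3.resolve_left fun ⟨j, hj, hjv⟩ => hu1 j hj
        (hjv.trans_lt v.2) (by rw [hjv]; exact hadj)
      have hlu : ∀ j : Fin m, slot m y (c u) (m + j) < u := fun j => (hu3 j j.2).1
      have hvr : ∀ j : Fin m, (v : ℕ) < slot m y (c u) (2 * m + j) := fun j => (hv3 j j.2).2.1
      have hrn : ∀ j : Fin m, slot m y (c u) (2 * m + j) < x.n := fun j => (hu3 j j.2).2.2.1
      let l : Fin m → Fin x.n := fun j => ⟨_, (hlu j).trans u.2⟩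
      let r : Fin m → Fin x.n := fun j => ⟨_, hrn j⟩
      let w' : Fin m → Fin x.n := fun j => ⟨w (m - 1 - j), (hw _ (by omega)).2.1.trans v.2⟩
      have hguess : ∀ z ∈ Set.range l ∪ Set.range r, ∃ j < 2 * m,
          slot m y (c u) (m + j) = (z : Fin x.n) := by
        rintro z (⟨j, rfl⟩ | ⟨j, rfl⟩)
        · exact ⟨j, by omega, rfl⟩
        · exact ⟨m + j, by omega, by simp [r, two_mul, add_assoc]⟩
      have hcolor : ∀ z ∈ Set.range w' ∪ {u, v}, c (z : Fin x.n) = c u ∧ u ≤ z ∧ z ≤ v := by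
        rintro z (⟨j, rfl⟩ | rfl | rfl)
        · obtain ⟨h1, h2, h3, -⟩ := hw (m - 1 - j) (by omega)
          exact ⟨h3, Fin.le_def.2 h1.le, Fin.le_def.2 h2.le⟩
        · exact ⟨rfl, le_rfl, huv.le⟩
        · exact ⟨hcol.symm, huv.le, le_rfl⟩
      have hgc : ∀ z ∈ Set.range l ∪ Set.range r, ∀ z' ∈ Set.range w' ∪ {u, v},
          ¬ x.G.Adj z z' := by
        intro z hz z' hz' h
        obtain ⟨j, hj, hjz⟩ := hguess z hz
        have := (hc z' z'.2).2.2.1 j hj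
        rw [(hcolor z' hz').1, hjz] at this
        exact this z.2 ((hA _ _).2 h.symm)
      refine not_orderedFree_of_conflict hab hedge huv ((hA _ _).1 hadj) l w' r ?_ ?_ ?_ hlu
        (fun j => (hw (m - 1 - j) (by omega)).1) (fun j => (hw (m - 1 - j) (by omega)).2.1) hvr
        ?_ hx
      · exact fun j j' h => ((hu3 j' j'.2).2.2.2 j h).1
      · exact fun j j' h => (hw (m - 1 - j) (by omega)).2.2.2 (m - 1 - j') (by omega)
      · exact fun j j' h => ((hu3 j' j'.2).2.2.2 j h).2
      · intro z z' hz hz' hzz' h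
        replace hz : z ∈ Set.range l ∪ Set.range r ∨ z ∈ Set.range w' ∪ {u, v} := by
          simp only [Set.mem_union] at hz ⊢; tauto
        replace hz' : z' ∈ Set.range l ∪ Set.range r ∨ z' ∈ Set.range w' ∪ {u, v} := by
          simp only [Set.mem_union] at hz' ⊢; tauto
        rcases hz with hz | hz <;> rcases hz' with hz' | hz'
        · obtain ⟨j, hj, hjz⟩ := hguess z hz
          obtain ⟨j', hj', hjz'⟩ := hguess z' hz'
          have := hu2 j hj j' hj'
          rw [hjz, hjz'] at this
          exact absurd ((hA _ _).2 h) (this z.2 z'.2)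
        · exact absurd h (hgc z hz z' hz')
        · exact absurd h.symm (hgc z' hz' z hz)
        · obtain ⟨h1, h2, h3⟩ := hcolor z hz
          obtain ⟨h1', h2', h3'⟩ := hcolor z' hz'
          by_contra hne
          refine ih ((z' : ℕ) - z) ?_ z z' hzz' rfl (h1.trans h1'.symm) ((hA _ _).2 h)
          have : ¬ ((z : ℕ) = u ∧ (z' : ℕ) = v) := by simpa [Fin.ext_iff] using hne
          simp only [Fin.le_def, Fin.lt_def] at *
          omega
  refine ⟨SimpleGraph.Coloring.mk (fun v => ⟨c v, (hc v v.2).1⟩) ?_, fun v => ?_⟩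
  · intro u v h heq
    have heq' : c u = c v := by simpa using heq
    rcases lt_trichotomy u v with huv | rfl | huv
    · exact hproper _ u v huv rfl heq' ((hA _ _).2 h)
    · exact h.ne rfl
    · exact hproper _ v u huv rfl heq'.symm ((hA _ _).2 h.symm)
  · exact (hL _ _).1 (hc v v.2).2.1

theorem exists_cell_of_isYes {m k : ℕ} (hm : 0 < m) (x : ListColInstance k)
    {A L : ℕ → ℕ → Prop} (hA : ∀ u v : Fin x.n, A u v ↔ x.G.Adj u v)
    (hL : ∀ (v : Fin x.n) (i : Fin k), L v i ↔ i ∈ x.L v) (hx : x.IsYes) :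
    ∃ y : ℕ → ℕ, (∀ p, y p ≤ x.n) ∧ Cell x.n m k A L x.n y := by
  obtain ⟨c, hc⟩ := hx
  let c' : ℕ → ℕ := fun v => if h : v < x.n then c ⟨v, h⟩ else 0
  have hc' : ∀ v : Fin x.n, c' v = c v := fun v => by simp [c']
  refine ⟨stateAt x.n m c' 0, stateAt_le _ _ _ (Nat.zero_le _), ?_⟩
  have := cell_stateAt (n := x.n) (k := k) (A := A) (L := L) hm (c := c') ?_ ?_ x.n le_rfl
  · rwa [Nat.sub_self] at this
  · intro u hu v hv h heq
    have hadj := (hA ⟨u, hu⟩ ⟨v, hv⟩).1 h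
    have h1 := hc' ⟨u, hu⟩
    have h2 := hc' ⟨v, hv⟩
    exact c.valid hadj (Fin.ext (h1.symm.trans (heq.trans h2)))
  · intro v hv
    have h1 : c' v = c ⟨v, hv⟩ := hc' ⟨v, hv⟩
    rw [h1]
    exact ⟨(c ⟨v, hv⟩).2, (hL ⟨v, hv⟩ _).2 (hc _)⟩

end Sweep

/-! ### Boolean expressions and nested loops -/

namespace RAM

namespace Expr

/-- An expression holds if its value is nonzero. -/
def Holds (s : State) (e : Expr) : Prop := e.eval s ≠ 0

/-- Negation. The connectives treat all nonzero values alike, as `Holds` does. -/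
def not (e : Expr) : Expr := .sub (.const 1) e

def or (a b : Expr) : Expr := .add a b

def and (a b : Expr) : Expr := not (or (not a) (not b))

def lt (a b : Expr) : Expr := .sub b a

def eq (a b : Expr) : Expr := not (or (lt a b) (lt b a))

/-- The conjunction of `f 0, …, f (n - 1)`. -/
def all : ℕ → (ℕ → Expr) → Expr
  | 0, _ => .const 1
  | n + 1, f => and (all n f) (f n)

/-- The disjunction of `f 0, …, f (n - 1)`. -/
def any : ℕ → (ℕ → Expr) → Expr
  | 0, _ => .const 0
  | n + 1, f => or (any n f) (f n)

variable {s : State}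

@[simp] theorem holds_not {e : Expr} : (not e).Holds s ↔ ¬ e.Holds s := by
  simp only [Holds, not, eval]; omega

@[simp] theorem holds_or {a b : Expr} : (or a b).Holds s ↔ a.Holds s ∨ b.Holds s := by
  simp only [Holds, or, eval]; omega

@[simp] theorem holds_and {a b : Expr} : (and a b).Holds s ↔ a.Holds s ∧ b.Holds s := by
  simp [and]

@[simp] theorem holds_lt {a b : Expr} : (lt a b).Holds s ↔ a.eval s < b.eval s := by
  simp only [Holds, lt, eval]; omega

@[simp] theorem holds_eq {a b : Expr} : (eq a b).Holds s ↔ a.eval s = b.eval s := by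
  simp only [eq, holds_not, holds_or, holds_lt]; omega

@[simp] theorem holds_all {n : ℕ} {f : ℕ → Expr} :
    (all n f).Holds s ↔ ∀ j < n, (f j).Holds s := by
  induction n with
  | zero => simp [all, Holds, eval]
  | succ n ih => rw [all, holds_and, ih, Nat.forall_lt_succ_right]

@[simp] theorem holds_any {n : ℕ} {f : ℕ → Expr} :
    (any n f).Holds s ↔ ∃ j < n, (f j).Holds s := by
  induction n with
  | zero => simp [any, Holds, eval]
  | succ n ih => rw [any, holds_or, ih, Nat.exists_lt_succ_right]

end Expr

/-- The number with leading digit `t` and further digits `y 0, …, y (d - 1)` in base `N`. -/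
def code (N t : ℕ) (y : ℕ → ℕ) : ℕ → ℕ
  | 0 => t
  | d + 1 => N * code N t y d + y d

theorem code_inj {N t t' : ℕ} {y y' : ℕ → ℕ} : ∀ {d : ℕ}, (∀ p < d, y p < N) →
    (∀ p < d, y' p < N) → code N t y d = code N t' y' d → t = t' ∧ ∀ p < d, y p = y' p
  | 0, _, _, h => ⟨h, by simp⟩
  | d + 1, hy, hy', h => by
    rw [Nat.forall_lt_succ_right] at hy hy' ⊢
    have hN : 0 < N := by omega
    rw [code, code] at h
    have h1 := congrArg (· / N) h
    have h2 := congrArg (· % N) h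
    simp only [Nat.mul_add_div hN, Nat.div_eq_of_lt hy.2, Nat.div_eq_of_lt hy'.2, add_zero,
      Nat.mul_add_mod, Nat.mod_eq_of_lt hy.2, Nat.mod_eq_of_lt hy'.2] at h1 h2
    obtain ⟨h3, h4⟩ := code_inj hy.1 hy'.1 h1
    exact ⟨h3, h4, h2⟩

theorem code_congr {N t : ℕ} {y y' : ℕ → ℕ} {d : ℕ} (h : ∀ p < d, y p = y' p) :
    code N t y d = code N t y' d := by
  induction d with
  | zero => rfl
  | succ d ih =>
    rw [code, code, ih fun p hp => h p (by omega), h d d.lt_succ_self]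

/-- The expression for `code N t y d`. -/
def Expr.code (t : Expr) (y : ℕ → Expr) : ℕ → Expr
  | 0 => t
  | d + 1 => .add (.mul (.var 0) (Expr.code t y d)) (y d)

theorem Expr.eval_code (s : State) (t : Expr) (y : ℕ → Expr) (d : ℕ) :
    (Expr.code t y d).eval s = RAM.code (s.reg 0) (t.eval s) (fun p => (y p).eval s) d := by
  induction d with
  | zero => rfl
  | succ d ih => simp [Expr.code, RAM.code, eval, ih]

/-- The table entry for `t` and `y`. The table lies behind the input, which fills the memory cells
below the content of register `0`. -/
def Expr.entry (t : Expr) (y : ℕ → Expr) (d : ℕ) : Expr := .add (.var 0) (Expr.code t y d)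

namespace Stmt

theorem run_loop_induction {x : ℕ} {p : Stmt} {s : State} (P : ℕ → State → Prop) (h0 : P 0 s)
    (hstep : ∀ j < s.reg 0, ∀ s', P j s' → P (j + 1) (p.run (s'.set x j))) :
    P (s.reg 0) ((loop x p).run s) := by
  have key : ∀ j ≤ s.reg 0, P j (Nat.rec s (fun j s' => p.run (s'.set x j)) j : State) := by
    intro j
    induction j with
    | zero => exact fun _ => h0
    | succ j ih => exact fun hj => hstep j hj _ (ih (by omega))
  exact key _ le_rfl

/-- The body `p` is run for all values below `N` of the `d` registers from `6` on. -/
def nest (p : Stmt) : ℕ → Stmt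
  | 0 => p
  | d + 1 => loop (6 + d) (nest p d)

theorem nest_wf {p : Stmt} (h : p.Wf) : ∀ d, (nest p d).Wf
  | 0 => h
  | d + 1 => ⟨by omega, nest_wf h d⟩

/-- The rule for nested loops: if a run of the body preserves an invariant, establishes `Q y` for
the current values `y` of the loop variables, and preserves `Q y` for all other `y`, then `Q y`
holds in the end for all `y`. -/
theorem nest_induction {p : Stmt} {d N : ℕ} {Inv : State → Prop} {Q : (ℕ → ℕ) → State → Prop}
    (h0 : ∀ s, Inv s → s.reg 0 = N)
    (hset : ∀ s q a, Inv s → Inv (s.set (6 + q) a))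
    (hsetQ : ∀ y s q a, Q y s → Q y (s.set (6 + q) a))
    (hreg : ∀ s r, 6 ≤ r → (p.run s).reg r = s.reg r)
    (hinv : ∀ s, Inv s → (∀ q < d, s.reg (6 + q) < N) → Inv (p.run s))
    (hQ : ∀ s, Inv s → (∀ q < d, s.reg (6 + q) < N) → ∀ y, (∀ q < d, y q < N) →
      ((∀ q < d, y q = s.reg (6 + q)) ∨ Q y s) → Q y (p.run s)) :
    ∀ s, Inv s → Inv ((nest p d).run s) ∧ ∀ y, (∀ q < d, y q < N) → Q y ((nest p d).run s) := by
  have key : ∀ e ≤ d, ∀ s, Inv s → (∀ q, e ≤ q → q < d → s.reg (6 + q) < N) →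
      Inv ((nest p e).run s) ∧ (∀ q, e ≤ q → ((nest p e).run s).reg (6 + q) = s.reg (6 + q)) ∧
      ∀ y, (∀ q < d, y q < N) → ((∀ q, e ≤ q → q < d → y q = s.reg (6 + q)) ∨ Q y s) →
        Q y ((nest p e).run s) := by
    intro e
    induction e with
    | zero =>
      intro _ s hs hlt
      replace hlt : ∀ q < d, s.reg (6 + q) < N := fun q => hlt q (Nat.zero_le q)
      refine ⟨hinv s hs hlt, fun q _ => hreg s _ (by omega), fun y hy h => hQ s hs hlt y hy ?_⟩
      exact h.imp_left fun h q => h q (Nat.zero_le q)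
    | succ e ih =>
      intro he s hs hlt
      have := run_loop_induction (x := 6 + e) (p := nest p e) (s := s) (fun j s' => Inv s' ∧
        (∀ q, e + 1 ≤ q → s'.reg (6 + q) = s.reg (6 + q)) ∧ ∀ y, (∀ q < d, y q < N) →
          (((∀ q, e + 1 ≤ q → q < d → y q = s.reg (6 + q)) ∧ y e < j) ∨ Q y s) → Q y s')
        ⟨hs, fun _ _ => rfl, fun y _ h => h.resolve_left (by simp)⟩ ?_
      · rw [h0 s hs] at this
        obtain ⟨h1, h2, h3⟩ := this
        exact ⟨h1, h2, fun y hy h => h3 y hy (h.imp_left fun h => ⟨h, hy e he⟩)⟩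
      · rintro j hj s' ⟨h1, h2, h3⟩
        rw [h0 s hs] at hj
        have hne : ∀ q, e + 1 ≤ q → (s'.set (6 + e) j).reg (6 + q) = s.reg (6 + q) := fun q hq => by
          rw [State.set_reg_of_ne _ _ (by omega), h2 q hq]
        obtain ⟨g1, g2, g3⟩ := ih (by omega) (s'.set (6 + e) j) (hset _ _ _ h1) (by
          intro q hq hqd
          rcases hq.eq_or_lt with rfl | hq
          · rwa [State.set_reg_self]
          · rw [hne q hq]
            exact hlt q hq hqd)
        refine ⟨g1, fun q hq => by rw [g2 q (by omega), hne q hq], fun y hy h => g3 y hy ?_⟩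
        by_cases hj' : (∀ q, e + 1 ≤ q → q < d → y q = s.reg (6 + q)) ∧ y e = j
        · left
          intro q hq hqd
          rcases hq.eq_or_lt with rfl | hq
          · rw [State.set_reg_self, hj'.2]
          · rw [hne q hq]
            exact hj'.1 q hq hqd
        · right
          refine hsetQ _ _ _ _ (h3 y hy (h.imp_left fun h => ⟨h.1, ?_⟩))
          have : y e ≠ j := fun hh => hj' ⟨h.1, hh⟩
          omega
  intro s hs
  obtain ⟨h1, -, h3⟩ := key d le_rfl s hs fun q h h' => absurd h' (by omega)
  exact ⟨h1, fun y hy => h3 y hy (.inl fun q h h' => absurd h' (by omega))⟩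

end Stmt

end RAM

/-! ### The program -/

namespace Sweep

open RAM

/-- The value of the adjacency matrix in row `u` and column `v`; register `1` contains `n`. -/
def adjExpr (u v : Expr) : Expr :=
  .load (.add (.add (.var 1) (.const 1)) (.add (.mul u (.var 1)) v))

/-- The entry of the lists for vertex `v` and color `i`. -/
def listExpr (k : ℕ) (v : Expr) (i : ℕ) : Expr :=
  .load (.add (.add (.var 1) (.const 1))
    (.add (.mul (.var 1) (.var 1)) (.add (.mul v (.const k)) (.const i))))

/-- Entry `p` of the current state is in register `6 + p`. -/
def slotExpr (m i j : ℕ) : Expr := .var (6 + (i * (3 * m) + j))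

/-- `w` is a vertex and adjacent to `u`. -/
def conflictExpr (u w : Expr) : Expr := .and (.lt w (.var 1)) (adjExpr u w)

/-- The expression for `Guess`; register `3` contains the vertex. -/
def guessExpr (m i : ℕ) : Expr :=
  .and (.all (2 * m) fun j => .not (conflictExpr (.var 3) (slotExpr m i (m + j))))
    (.and (.all (2 * m) fun j => .all (2 * m) fun j' =>
        .not (.and (.lt (slotExpr m i (m + j)) (.var 1))
          (conflictExpr (slotExpr m i (m + j)) (slotExpr m i (m + j')))))
      (.or (.any (2 * m) fun j => .eq (slotExpr m i (m + j)) (.var 3))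
        (.all m fun j => .and (.lt (slotExpr m i (m + j)) (.var 3))
          (.and (.lt (.var 3) (slotExpr m i (2 * m + j)))
            (.and (.lt (slotExpr m i (2 * m + j)) (.var 1))
              (.all j fun j' => .and (.lt (slotExpr m i (m + j')) (slotExpr m i (m + j)))
                (.lt (slotExpr m i (2 * m + j')) (slotExpr m i (2 * m + j)))))))))

/-- The expression for entry `p` of `shift`. -/
def shiftExpr (m i p : ℕ) : Expr :=
  if p / (3 * m) = i ∧ p % (3 * m) < m then
    if p % (3 * m) = 0 then .var 3 else .var (6 + (p - 1))
  else .var (6 + p)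

/-- The expression for `Cell`, where the entries for smaller `t` are read from the table; register
`2` contains `t`. -/
def cellExpr (m k : ℕ) : Expr :=
  .or (.eq (.var 2) (.const 0)) (.any k fun i => .and (listExpr k (.var 3) i)
    (.and (.all m fun j => .not (conflictExpr (.var 3) (slotExpr m i j)))
      (.and (guessExpr m i)
        (.load (.entry (.sub (.var 2) (.const 1)) (shiftExpr m i) (k * (3 * m)))))))

/-- Count the leading ones of the input, which gives `n`; fill the table for `t = 0, 1, …`; add up
the entries for `t = n` in register `4`. -/
def program (m k : ℕ) : Stmt :=
  .seq (.loop 5 (.assign 1 (.add (.var 1) (.load (.var 1)))))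
    (.seq (.loop 2 (.seq (.assign 3 (.sub (.var 1) (.var 2)))
      (.nest (.store (.entry (.var 2) (fun p => .var (6 + p)) (k * (3 * m))) (cellExpr m k))
        (k * (3 * m)))))
      (.nest (.assign 4 (.add (.var 4)
        (.load (.entry (.var 1) (fun p => .var (6 + p)) (k * (3 * m)))))) (k * (3 * m))))

theorem program_wf (m k : ℕ) : (program m k).Wf :=
  ⟨⟨Nat.succ_ne_zero 4, Nat.succ_ne_zero 0⟩,
    ⟨Nat.succ_ne_zero 1, Nat.succ_ne_zero 2, Stmt.nest_wf (p := .store _ _) trivial _⟩,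
    Stmt.nest_wf (p := .assign _ _) (Nat.succ_ne_zero 3) _⟩

/-! ### Correctness of the program -/

section Correctness

variable {N n m k t : ℕ} {A L : ℕ → ℕ → Prop} {s : State} {y : ℕ → ℕ}

theorem holds_conflictExpr (h0 : s.reg 0 = N) (hn : s.reg 1 = n) (hnN : n < N)
    (hA : ∀ u < n, ∀ v < n, s.mem (n + 1 + (u * n + v)) ≠ 0 ↔ A u v) {u w : Expr}
    (hu : u.eval s < n) :
    (conflictExpr u w).Holds s ↔ w.eval s < n ∧ A (u.eval s) (w.eval s) := by
  rw [conflictExpr, Expr.holds_and, Expr.holds_lt, Expr.eval, hn]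
  refine and_congr_right fun hw => ?_
  rw [← hA _ hu _ hw]
  simp only [Expr.Holds, adjExpr, Expr.eval, hn, h0, min_eq_left (hu.le.trans hnN.le)]

theorem eval_slotExpr (hy : ∀ p < k * (3 * m), s.reg (6 + p) = y p) {i j : ℕ} (hi : i < k)
    (hj : j < 3 * m) : (slotExpr m i j).eval s = slot m y i j := by
  refine hy _ ?_
  calc i * (3 * m) + j < i * (3 * m) + 3 * m := by omega
    _ = (i + 1) * (3 * m) := by ring
    _ ≤ k * (3 * m) := Nat.mul_le_mul_right _ hi

theorem holds_guessExpr (h0 : s.reg 0 = N) (hn : s.reg 1 = n) (hnN : n < N)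
    (hA : ∀ u < n, ∀ v < n, s.mem (n + 1 + (u * n + v)) ≠ 0 ↔ A u v) {v i : ℕ} (hv : v < n)
    (h3 : s.reg 3 = v) (hi : i < k) (hy : ∀ p < k * (3 * m), s.reg (6 + p) = y p) :
    (guessExpr m i).Holds s ↔ Guess n m A y v i := by
  have hs : ∀ j < 3 * m, (slotExpr m i j).eval s = slot m y i j := fun j =>
    eval_slotExpr hy hi
  have e1 : (Expr.var 1).eval s = n := hn
  have e3 : (Expr.var 3).eval s = v := h3
  simp only [guessExpr, Guess, Expr.holds_and, Expr.holds_or, Expr.holds_all, Expr.holds_any,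
    Expr.holds_not, Expr.holds_lt, Expr.holds_eq, e1, e3]
  refine and_congr ?_ (and_congr ?_ (or_congr ?_ ?_))
  · refine forall₂_congr fun j hj => ?_
    rw [holds_conflictExpr h0 hn hnN hA (by rwa [e3]), e3, hs _ (by omega), not_and]
  · refine forall₂_congr fun j hj => forall₂_congr fun j' hj' => ?_
    rw [hs (m + j) (by omega), not_and]
    refine imp_congr_right fun hlt => ?_
    rw [holds_conflictExpr h0 hn hnN hA (by rwa [hs (m + j) (by omega)]), hs (m + j) (by omega),
      hs (m + j') (by omega), not_and]
  · refine exists_congr fun j => and_congr_right fun hj => ?_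
    rw [hs (m + j) (by omega)]
  · refine forall₂_congr fun j hj => ?_
    rw [hs (m + j) (by omega), hs (2 * m + j) (by omega)]
    refine and_congr_right fun _ => and_congr_right fun _ => and_congr_right fun _ =>
      forall₂_congr fun j' hj' => ?_
    rw [hs (m + j') (by omega), hs (2 * m + j') (by omega)]

/-- The table entry for `t` and `y` is computed correctly, provided that those for smaller `t` are
correct. -/
theorem holds_cellExpr (h0 : s.reg 0 = N) (hn : s.reg 1 = n) (h2 : s.reg 2 = t)
    (h3 : s.reg 3 = n - t) (hnN : n < N) (ht : t ≤ n)
    (hA : ∀ u < n, ∀ v < n, s.mem (n + 1 + (u * n + v)) ≠ 0 ↔ A u v)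
    (hL : ∀ v < n, ∀ i < k, s.mem (n + 1 + (n * n + (v * k + i))) ≠ 0 ↔ L v i)
    (hy : ∀ p < k * (3 * m), s.reg (6 + p) = y p) (hyN : ∀ p < k * (3 * m), y p < N)
    (hT : ∀ t' < t, ∀ y, (∀ p < k * (3 * m), y p < N) →
      (s.mem (N + code N t' y (k * (3 * m))) ≠ 0 ↔ Cell n m k A L t' y)) :
    (cellExpr m k).Holds s ↔ Cell n m k A L t y := by
  have e2 : (Expr.var 2).eval s = t := h2
  have e3 : (Expr.var 3).eval s = n - t := h3
  have ec : ∀ c, (Expr.const c).eval s = c := fun _ => rfl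
  rw [cellExpr, Expr.holds_or, Expr.holds_eq, Expr.holds_any, e2, ec]
  rcases t with _ | t
  · simp [Cell]
  have hv : n - (t + 1) < n := by omega
  simp only [t.succ_ne_zero, false_or, Cell, Expr.holds_and, Expr.holds_all, Expr.holds_not]
  refine exists_congr fun i => and_congr_right fun hi => and_congr ?_ (and_congr ?_
    (and_congr (holds_guessExpr h0 hn hnN hA hv h3 hi hy) ?_))
  · rw [← hL _ hv i hi]
    simp only [Expr.Holds, listExpr, Expr.eval, hn, h0, h3, min_eq_left hnN.le,
      min_eq_left (hv.le.trans hnN.le)]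
  · refine forall₂_congr fun j hj => ?_
    rw [holds_conflictExpr h0 hn hnN hA (by rwa [e3]), e3, eval_slotExpr hy hi (by omega), not_and]
  · have hshift : ∀ p < k * (3 * m),
        (shiftExpr m i p).eval s = shift m i (n - (t + 1)) y p := by
      intro p hp
      rw [shiftExpr, shift]
      split_ifs
      · exact h3
      · exact hy _ (by omega)
      · exact hy _ hp
    rw [← hT t t.lt_succ_self]
    · simp only [Expr.Holds, Expr.entry, Expr.eval, Expr.eval_code, h0, h2]
      rw [code_congr hshift, Nat.add_sub_cancel]
    · intro p hp
      rw [shift]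
      split_ifs
      · omega
      · exact hyN _ (by omega)
      · exact hyN _ hp

/-- On a memory that starts with the encoding of a graph with `n` vertices, where `N` is the length
of the encoding, the program leaves a nonzero number in register `4` exactly if the sweep succeeds
from some state. The converse direction needs a state whose entries the loops reach. -/
theorem run_program_reg_ne_zero (hN : N = n + 1 + (n * n + n * k)) (h0 : s.reg 0 = N)
    (h1 : s.reg 1 = 0) (h4 : s.reg 4 = 0) (hone : ∀ a < n, s.mem a = 1) (hzero : s.mem n = 0)
    (hA : ∀ u < n, ∀ v < n, s.mem (n + 1 + (u * n + v)) ≠ 0 ↔ A u v)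
    (hL : ∀ v < n, ∀ i < k, s.mem (n + 1 + (n * n + (v * k + i))) ≠ 0 ↔ L v i) :
    (((program m k).run s).reg 4 ≠ 0 → ∃ y, Cell n m k A L n y) ∧
      ∀ y, (∀ p, y p < N) → Cell n m k A L n y → ((program m k).run s).reg 4 ≠ 0 := by
  have hnN : n < N := by omega
  set d := k * (3 * m)
  -- The table entries for `t` and `y` are correct in the memory `M`.
  let Good (M : ℕ → ℕ) (t : ℕ) (y : ℕ → ℕ) : Prop :=
    M (N + code N t y d) ≠ 0 ↔ Cell n m k A L t y
  rw [program, Stmt.run, Stmt.run]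
  set s₁ := (Stmt.loop 5 (.assign 1 (.add (.var 1) (.load (.var 1))))).run s
  obtain ⟨g0, g1, g4, gm⟩ : s₁.reg 0 = N ∧ s₁.reg 1 = n ∧ s₁.reg 4 = 0 ∧ s₁.mem = s.mem := by
    have := Stmt.run_loop_induction (x := 5) (p := .assign 1 (.add (.var 1) (.load (.var 1))))
      (s := s) (fun j s' => s'.reg 0 = N ∧ s'.reg 1 = min j n ∧ s'.reg 4 = 0 ∧ s'.mem = s.mem)
      ⟨h0, by simp [h1], h4, rfl⟩ ?_
    · rwa [h0, min_eq_right hnN.le] at this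
    · rintro j - s' ⟨a0, a1, a4, am⟩
      refine ⟨by simp [Stmt.run, State.set, a0], ?_, by simp [Stmt.run, State.set, a4],
        by simp [Stmt.run, am]⟩
      simp only [Stmt.run, State.set_reg_self, Expr.eval, State.set_mem, am,
        State.set_reg_of_ne s' j (show 1 ≠ 5 by decide), a1]
      rcases lt_or_ge j n with hj | hj
      · rw [min_eq_left hj.le, hone j hj, min_eq_left (Nat.succ_le_of_lt hj)]
      · rw [min_eq_right hj, hzero, min_eq_right (by omega), add_zero]
  -- The rounds with `t > n` write entries that are never used; only `t ≤ n` matters.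
  set q := Stmt.loop 2 (.seq (.assign 3 (.sub (.var 1) (.var 2)))
    (.nest (.store (.entry (.var 2) (fun p => .var (6 + p)) d) (cellExpr m k)) d))
  obtain ⟨f0, f1, f4, -, fT⟩ : (q.run s₁).reg 0 = N ∧ (q.run s₁).reg 1 = n ∧
      (q.run s₁).reg 4 = 0 ∧ (∀ a < N, (q.run s₁).mem a = s.mem a) ∧ ∀ t < N, t ≤ n →
        ∀ y, (∀ p < d, y p < N) → Good (q.run s₁).mem t y := by
    have := Stmt.run_loop_induction (x := 2) (p := .seq (.assign 3 (.sub (.var 1) (.var 2)))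
      (.nest (.store (.entry (.var 2) (fun p => .var (6 + p)) d) (cellExpr m k)) d)) (s := s₁)
      (fun j s' => s'.reg 0 = N ∧ s'.reg 1 = n ∧ s'.reg 4 = 0 ∧ (∀ a < N, s'.mem a = s.mem a) ∧
        ∀ t < j, t ≤ n → ∀ y, (∀ p < d, y p < N) → Good s'.mem t y)
      ⟨g0, g1, g4, fun a _ => by rw [gm], by simp⟩ ?_
    · rwa [g0] at this
    rintro t - s₂ ⟨b0, b1, b4, bm, bT⟩
    rw [Stmt.run]
    let Inv (s' : State) : Prop := s'.reg 0 = N ∧ s'.reg 1 = n ∧ s'.reg 2 = t ∧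
      s'.reg 3 = n - t ∧ s'.reg 4 = 0 ∧ (∀ a < N, s'.mem a = s.mem a) ∧
      ∀ t' < t, t' ≤ n → ∀ y, (∀ p < d, y p < N) → Good s'.mem t' y
    have hentry : ∀ s', Inv s' →
        (Expr.entry (.var 2) (fun p => .var (6 + p)) d).eval s' =
          N + code N t (fun p => s'.reg (6 + p)) d := by
      rintro s' ⟨c0, -, c2, -⟩
      simp [Expr.entry, Expr.eval, Expr.eval_code, c0, c2]
    obtain ⟨⟨i0, i1, -, -, i4, im, iT⟩, iQ⟩ := Stmt.nest_induction (d := d) (N := N)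
      (p := .store (.entry (.var 2) (fun p => .var (6 + p)) d) (cellExpr m k))
      (Inv := Inv) (Q := fun y s' => t ≤ n → Good s'.mem t y)
      (fun s' h => h.1)
      (fun s' r a ⟨c0, c1, c2, c3, c4, cm, cT⟩ => ⟨
        by rwa [State.set_reg_of_ne _ _ (by omega)], by rwa [State.set_reg_of_ne _ _ (by omega)],
        by rwa [State.set_reg_of_ne _ _ (by omega)], by rwa [State.set_reg_of_ne _ _ (by omega)],
        by rwa [State.set_reg_of_ne _ _ (by omega)], cm, cT⟩)
      (fun y s' r a h => h) (fun s' r _ => rfl)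
      (by
        intro s' hI hlt
        have he := hentry s' hI
        obtain ⟨c0, c1, c2, c3, c4, cm, cT⟩ := hI
        refine ⟨c0, c1, c2, c3, c4, fun a ha => ?_, fun t' ht' htn y hy => ?_⟩
        · simp only [Stmt.run, he]
          rw [Function.update_of_ne (by omega), cm a ha]
        · have hne : N + code N t' y d ≠ N + code N t (fun p => s'.reg (6 + p)) d := fun h =>
            ht'.ne (code_inj hy hlt (Nat.add_left_cancel h)).1
          simp only [Good, Stmt.run, he, Function.update_of_ne hne]
          exact cT t' ht' htn y hy)
      (by
        intro s' hI hlt y hy h htn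
        have he := hentry s' hI
        obtain ⟨c0, c1, c2, c3, c4, cm, cT⟩ := hI
        simp only [Good, Stmt.run, he]
        by_cases hyy : ∀ p < d, y p = s'.reg (6 + p)
        · rw [code_congr hyy, Function.update_self]
          refine holds_cellExpr c0 c1 c2 c3 hnN htn (fun u hu v hv => ?_) (fun v hv i hi => ?_)
            (fun p hp => (hyy p hp).symm) hy fun t' ht' => cT t' ht' (by omega)
          · rw [cm, hA u hu v hv]
            have : (u + 1) * n ≤ n * n := Nat.mul_le_mul_right _ hu
            rw [Nat.succ_mul] at this
            omega
          · rw [cm, hL v hv i hi]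
            have : (v + 1) * k ≤ n * k := Nat.mul_le_mul_right _ hv
            rw [Nat.succ_mul] at this
            omega
        · have hne : N + code N t y d ≠ N + code N t (fun p => s'.reg (6 + p)) d := fun h =>
            hyy (code_inj hy hlt (Nat.add_left_cancel h)).2
          rw [Function.update_of_ne hne]
          exact h.resolve_left hyy htn)
      ((Stmt.assign 3 (.sub (.var 1) (.var 2))).run (s₂.set 2 t))
      ⟨by simp [Stmt.run, State.set, b0], by simp [Stmt.run, State.set, b1],
        by simp [Stmt.run, State.set], by simp [Stmt.run, State.set, Expr.eval, b1],
        by simp [Stmt.run, State.set, b4], bm, bT⟩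
    refine ⟨i0, i1, i4, im, fun t' ht' htn => ?_⟩
    rcases Nat.lt_succ_iff_lt_or_eq.1 ht' with ht' | rfl
    · exact iT t' ht' htn
    · exact fun y hy => iQ y hy htn
  set s₂ := q.run s₁
  have hentry : ∀ s' : State, s'.reg 0 = N → s'.reg 1 = n → s'.mem = s₂.mem →
      (Expr.add (.var 4) (.load (.entry (.var 1) (fun p => .var (6 + p)) d))).eval s' =
        s'.reg 4 + s₂.mem (N + code N n (fun p => s'.reg (6 + p)) d) := by
    intro s' c0 c1 cm
    simp [Expr.entry, Expr.eval, Expr.eval_code, c0, c1, cm]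
  obtain ⟨⟨-, -, -, h⟩, h'⟩ := Stmt.nest_induction (d := d) (N := N)
    (p := .assign 4 (.add (.var 4) (.load (.entry (.var 1) (fun p => .var (6 + p)) d))))
    (Inv := fun s' => s'.reg 0 = N ∧ s'.reg 1 = n ∧ s'.mem = s₂.mem ∧
      (s'.reg 4 ≠ 0 → ∃ y, Cell n m k A L n y))
    (Q := fun y s' => Cell n m k A L n y → s'.reg 4 ≠ 0)
    (fun s' h => h.1)
    (fun s' r a ⟨c0, c1, cm, c4⟩ => ⟨by rwa [State.set_reg_of_ne _ _ (by omega)],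
      by rwa [State.set_reg_of_ne _ _ (by omega)], cm,
      by rwa [State.set_reg_of_ne _ _ (by omega)]⟩)
    (fun y s' r a h => by rwa [State.set_reg_of_ne _ _ (by omega)])
    (fun s' r hr => State.set_reg_of_ne _ _ (by omega))
    (by
      rintro s' ⟨c0, c1, cm, c4⟩ hlt
      refine ⟨by simp [Stmt.run, State.set, c0], by simp [Stmt.run, State.set, c1], cm, ?_⟩
      rw [Stmt.run, State.set_reg_self, hentry s' c0 c1 cm]
      intro hne
      by_cases h4 : s'.reg 4 = 0
      · rw [h4, zero_add] at hne
        exact ⟨_, (fT n hnN le_rfl _ hlt).1 hne⟩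
      · exact c4 h4)
    (by
      rintro s' ⟨c0, c1, cm, c4⟩ hlt y hy h hc
      rw [Stmt.run, State.set_reg_self, hentry s' c0 c1 cm]
      rcases h with h | h
      · have := (fT n hnN le_rfl y hy).2 hc
        rw [code_congr h] at this
        omega
      · have := h hc
        omega)
    s₂ ⟨f0, f1, rfl, fun h => absurd f4 h⟩
  exact ⟨h, fun y hy => h' y fun p _ => hy p⟩

end Correctness

end Sweep

/-! ### Reading the encoding -/

namespace ListColInstance

variable {k : ℕ} (x : ListColInstance k)

theorem length_encode : x.encode.length = x.n + 1 + (x.n * x.n + x.n * k) := by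
  simp [encode]; ring

theorem init_encode_of_lt {a : ℕ} (ha : a < x.n) : (RAM.init x.encode).mem a = 1 := by
  simp [RAM.init, encode, List.getElem?_append, ha]

theorem init_encode_n : (RAM.init x.encode).mem x.n = 0 := by
  simp [RAM.init, encode, List.getElem?_append]

theorem mul_add_lt {a b : ℕ} (u : Fin a) (v : Fin b) : (u : ℕ) * b + v < a * b := by
  have : ((u : ℕ) + 1) * b ≤ a * b := Nat.mul_le_mul_right _ u.2
  rw [Nat.succ_mul] at this
  omega

/-- A matrix that is listed row by row is read back at its positions. -/
theorem getD_ofFn_divNat_modNat {a b : ℕ} (f : Fin a → Fin b → Bool) (u : Fin a) (v : Fin b) :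
    (List.ofFn fun i : Fin (a * b) => f i.divNat i.modNat).getD (u * b + v) false = f u v := by
  rw [List.getD_eq_getElem _ _ (by simpa using mul_add_lt u v), List.getElem_ofFn]
  congr 1 <;> ext
  · simp [mul_comm (u : ℕ) b, Nat.mul_add_div (Fin.pos v), Nat.div_eq_of_lt v.2]
  · simp [Nat.mod_eq_of_lt v.2]

theorem init_mem_ne_zero (l : List Bool) (a : ℕ) :
    (RAM.init l).mem a ≠ 0 ↔ l.getD a false = true := by
  simp only [RAM.init]
  split_ifs with h <;> simp only [ne_eq, one_ne_zero, not_false_eq_true, not_true_eq_false,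
    h, Bool.false_eq_true]

open Classical in
theorem init_encode_adj (u v : Fin x.n) :
    (RAM.init x.encode).mem (x.n + 1 + (u * x.n + v)) ≠ 0 ↔ x.G.Adj u v := by
  have h := mul_add_lt u v
  rw [init_mem_ne_zero, encode, List.getD_append _ _ _ _ (by simp; omega),
    List.getD_append_right _ _ _ _ (by simp), show x.n + 1 + (u * x.n + v) -
      (List.replicate x.n true ++ [false]).length = u * x.n + v by simp,
    getD_ofFn_divNat_modNat (fun u v => decide (x.G.Adj u v)), decide_eq_true_iff]

open Classical in
theorem init_encode_list (v : Fin x.n) (i : Fin k) :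
    (RAM.init x.encode).mem (x.n + 1 + (x.n * x.n + (v * k + i))) ≠ 0 ↔ i ∈ x.L v := by
  rw [init_mem_ne_zero, encode, List.getD_append_right _ _ _ _ (by simp; omega)]
  simp only [List.length_append, List.length_replicate, List.length_singleton, List.length_ofFn]
  rw [← add_assoc (x.n + 1), Nat.add_sub_cancel_left,
    getD_ofFn_divNat_modNat (fun v i => decide (i ∈ x.L v)), decide_eq_true_iff]

end ListColInstance

theorem theorem3p1 {V : Type*} [Fintype V] [LinearOrder V] (H : SimpleGraph V)
    (hH : H.edgeSet.ncard = 1) (k : ℕ) :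
    RAM.SolvableInPolyTime
      (fun x : {x : ListColInstance k // OrderedFree H x.G} => x.1.encode)
      (fun x => x.1.IsYes) := by
  have hm : 0 < Fintype.card V := by
    obtain ⟨a, -⟩ := Sweep.exists_edge_of_ncard_edgeSet_eq_one hH
    exact Fintype.card_pos_iff.2 ⟨a⟩
  refine RAM.Stmt.solvableInPolyTime (Sweep.program (Fintype.card V) k) (Sweep.program_wf _ _) 4 ?_
  rintro ⟨x, hx⟩
  let A u v := (RAM.init x.encode).mem (x.n + 1 + (u * x.n + v)) ≠ 0
  let L v i := (RAM.init x.encode).mem (x.n + 1 + (x.n * x.n + (v * k + i))) ≠ 0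
  have hA : ∀ u v : Fin x.n, A u v ↔ x.G.Adj u v := x.init_encode_adj
  have hL : ∀ (v : Fin x.n) (i : Fin k), L v i ↔ i ∈ x.L v := x.init_encode_list
  obtain ⟨h₁, h₂⟩ := Sweep.run_program_reg_ne_zero (m := Fintype.card V) (A := A) (L := L)
    (s := RAM.init x.encode) x.length_encode rfl rfl rfl (fun _ => x.init_encode_of_lt)
    x.init_encode_n (fun _ _ _ _ => Iff.rfl) fun _ _ _ _ => Iff.rfl
  refine ⟨fun h => ?_, fun h => ?_⟩
  · obtain ⟨y, hy⟩ := h₁ h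
    exact hy.isYes hH x hx hA hL
  · obtain ⟨y, hy, hc⟩ := Sweep.exists_cell_of_isYes hm x hA hL h
    exact h₂ y (fun p => by have := hy p; rw [x.length_encode]; omega) hc
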